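/- For a sequence $(x_n)_{n\ge 1}$ in $[0,1)$ let $$D_N=\sup_{0<a<b<1}\Big|\tfrac1N|\{n\le N: x_n\in(a,b)\}|-(b-a)\Big|$$ be its discrepancy. For $N\in\mathbb N$ and real $0<L\le N$ let $Y$ be uniformly distributed on $[0,1)$ and $W=|\{n\le N: x_n\in[Y,Y+L/N] \bmod 1\}|$. For $k\ge 2$ and $g:\mathbb R^{k-1}\to[0,1]$ compactly supported let $$R_k(L,N,g)=\frac1N\sum_{\substack{1\le n_1,\dots,n_k\le N\\ \text{distinct}}} g\Big(\tfrac NL\{x_{n_1}-x_{n_2}\}_{\rm sgn},\dots,\tfrac NL\{x_{n_{k-1}}-x_{n_k}\}_{\rm sgn}\Big),$$ where $\{t\}_{\rm sgn}\in(-1/2,1/2]$ is the signed distance from $t$ to the nearest integer. For real numbers $\beta$ and $\varepsilon>0$ consider the following two estimates. (M) For every integer $k\ge2$ and all $N\ge1$, $N^{\beta+\varepsilon}<L\le N$: $\ \mathbb E W^k=L^k\big(1+O(kN^{-\varepsilon/2})\big)$. The implied constant is independent of $L$ and $N$; it may depend on $(x_n)$, $\beta$, $\varepsilon$ and $k$,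 but if one restricts to $k\le N^{\varepsilon/2}$ (which, for each $k$, holds for all large $N$), it can be chosen independent of $k$ as well. (C) For every integer $k\ge 2$ and every compactly supported continuous $g:\mathbb R^{k-1}\to[0,1]$, as $N\to\infty$, uniformly in $N^{\beta+\varepsilon}<L<N^{1-\varepsilon}$: $\ R_k(L,N,g)=(1+o(1))\,L^{k-1}\int_{\mathbb R^{k-1}} g(w)\,dw$. (a) Let $(x_n)_{n\ge1}$ be a sequence in $[0,1)$ such that $\gamma=\sup\{s>0:\ D_N\ll_s N^{-s}\text{ for all }N\ge1\}$ is positive (the set being non-empty). Then (M) and (C) hold with $\beta=1-\gamma$ for every $\varepsilon>0$. (b) Let $(a_n)_{n\ge1}$ be a strictly increasing sequence of integers. Then for almost every $\alpha\in[0,1]$ the sequence $x_n=\alpha a_n \bmod 1$ satisfies (M) and (C) with $\beta=1/2$ for every $\varepsilon>0$. -/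

import Mathlib

open MeasureTheory

noncomputable section

/-- The discrepancy `D_N` of the real sequence `x 1, x 2, …` (the value `x 0` is never used). -/
def discrepancy (x : ℕ → ℝ) (N : ℕ) : ℝ :=
  sSup {d : ℝ | ∃ a b : ℝ, 0 < a ∧ a < b ∧ b < 1 ∧
    d = |(({n ∈ Finset.Icc 1 N | a < x n ∧ x n < b}.card : ℕ) : ℝ) / N - (b - a)|}

open Classical in
/-- The number of `1 ≤ n ≤ N` such that `x n` lies in `[y, y + L / N]` modulo `1`. -/
def windowCount (x : ℕ → ℝ) (L : ℝ) (N : ℕ) (y : ℝ) : ℕ :=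
  {n ∈ Finset.Icc 1 N | ∃ m : ℤ, x n + m ∈ Set.Icc y (y + L / N)}.card

/-- The moment `𝔼 W ^ k`, where `W = windowCount x L N Y` and `Y` is uniform on `[0, 1)`. -/
def windowMoment (x : ℕ → ℝ) (L : ℝ) (N k : ℕ) : ℝ :=
  ∫ y in Set.Ico (0 : ℝ) 1, (windowCount x L N y : ℝ) ^ k

/-- The signed distance to the nearest integer, with values in `(-1/2, 1/2]`. -/
def sgnDist (t : ℝ) : ℝ := t - ⌈t - 1 / 2⌉

open Classical in
/-- The `k`-th correlation function `R_k(x, L, N, g)`: the sum is over all `k`-tuples of pairwise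
distinct indices in `{1, …, N}`. -/
def correlation (x : ℕ → ℝ) (k : ℕ) (L : ℝ) (N : ℕ) (g : (Fin (k - 1) → ℝ) → ℝ) : ℝ :=
  1 / (N : ℝ) *
    ∑ n ∈ {n ∈ Fintype.piFinset fun _ : Fin k => Finset.Icc 1 N | Function.Injective n},
      g fun i : Fin (k - 1) =>
        N / L * sgnDist (x (n ⟨i, Nat.lt_of_lt_pred i.2⟩) - 
          x (n ⟨i + 1, Nat.add_lt_of_lt_sub i.2⟩))

/-- `𝔼 W ^ k = L ^ k * (1 + O(k * N ^ (-ε / 2)))` in the range `N ^ (β + ε) < L ≤ N`, where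
`W = windowCount x L N Y` and `k ≥ 2`. The implied constant is independent of `L`, `N` and `k` as
long as `k * N ^ (-ε / 2) ≤ 1` (so, for each `k`, for all large `N`); for each fixed `k` the
estimate holds for all `N` with a constant that may depend on `k`. -/
def MomentEstimate (x : ℕ → ℝ) (β ε : ℝ) : Prop :=
  (∃ C : ℝ, ∀ k : ℕ, 2 ≤ k → ∀ N : ℕ, 1 ≤ N → (k : ℝ) * (N : ℝ) ^ (-ε / 2) ≤ 1 →
    ∀ L : ℝ, (N : ℝ) ^ (β + ε) < L → L ≤ N →
      |windowMoment x L N k - L ^ k| ≤ C * (k * (N : ℝ) ^ (-ε / 2)) * L ^ k) ∧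
  (∀ k : ℕ, 2 ≤ k → ∃ C : ℝ, ∀ N : ℕ, 1 ≤ N →
    ∀ L : ℝ, (N : ℝ) ^ (β + ε) < L → L ≤ N →
      |windowMoment x L N k - L ^ k| ≤ C * (k * (N : ℝ) ^ (-ε / 2)) * L ^ k)

/-- `R_k(x, L, N, g) = (1 + o(1)) * L ^ (k - 1) * ∫ g` as `N → ∞`, uniformly in the range
`N ^ (β + ε) < L < N ^ (1 - ε)`, for all `k ≥ 2` and all compactly supported continuous
`g : ℝ ^ (k - 1) → [0, 1]`. -/
def CorrelationEstimate (x : ℕ → ℝ) (β ε : ℝ) : Prop :=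
  ∀ k : ℕ, 2 ≤ k → ∀ g : (Fin (k - 1) → ℝ) → ℝ,
    Continuous g → HasCompactSupport g → (∀ w, g w ∈ Set.Icc (0 : ℝ) 1) →
      ∀ η : ℝ, 0 < η → ∃ N₀ : ℕ, ∀ N : ℕ, N₀ ≤ N →
        ∀ L : ℝ, (N : ℝ) ^ (β + ε) < L → L < (N : ℝ) ^ (1 - ε) →
          |correlation x k L N g - L ^ (k - 1) * ∫ w, g w| ≤ η * (L ^ (k - 1) * ∫ w, g w)

end

/-!
Both parts follow from a power saving in the discrepancy: if `D_N ≪ N ^ (-s)`, then every arc of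
length `L / N` on the circle contains `L + O(N ^ (1 - s))` of the first `N` points
(`abs_windowCount_sub_le`). In the range `L > N ^ (β + ε)` with `1 - s ≤ β + ε / 2` the error is
`O(L N ^ (-ε / 2))`, uniformly in the position of the arc.

*Moments.* The window count is `L (1 + O(N ^ (-ε / 2)))` pointwise, so its `k`-th power is
`L ^ k (1 + O(k N ^ (-ε / 2)))` pointwise, and it remains to integrate.

*Correlations.* The sum over the indices is carried out one index at a time
(`exists_forall_abs_sum_distinctTuples_sub_le`). For fixed remaining indices, the sum over the first
index of a function of the rescaled distance to the second point is `L` times an integral, because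
short arcs contain the right number of points (`abs_mul_sum_sub_le`); the boundedly many
excluded indices contribute `O(1) = o(L)`. The resulting partial integral of the test function is
again continuous and compactly supported, so that induction applies. Only `β ≥ 0` is needed to have
`L → ∞`, and the exponent in a discrepancy bound never exceeds `1` since `N D_N ≫ 1`.

*Metric part.* For `x_n = α a_n mod 1` it is enough to show `D_N ≪ N ^ (-1 / 2 + o(1))` for almost
every `α`. A smoothed Erdős–Turán inequality (`mul_discrepancy_le`), which rests on the absolutely
convergent Fourier series of the second Bernoulli function, bounds `N D_N` by
`N ^ η ∑_h h ^ (-1 - η) |∑_{n ≤ N} e(h α a_n)| + 1`. For `h ≠ 0` the functions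
`α ↦ e(h α a_n)` are orthonormal on `[0, 1]`, hence a sum over a block of indices has mean square
equal to the length of the block. By the maximal inequality of Rademacher–Menshov
(`norm_sum_Ico_sq_le`) all initial sums are controlled by sums over dyadic blocks, and a suitably
weighted series of all of these squares, over all levels and frequencies, has a finite integral;
therefore it converges almost everywhere (`ae_summable_dyadicEnergy`), which gives the bound for
all `N` at once.
-/

noncomputable section

/-! ### Discrepancy and counts in arcs -/

theorem discrepancy_bddAbove (x : ℕ → ℝ) (N : ℕ) :
    BddAbove {d : ℝ | ∃ a b : ℝ, 0 < a ∧ a < b ∧ b < 1 ∧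
      d = |(({n ∈ Finset.Icc 1 N | a < x n ∧ x n < b}.card : ℕ) : ℝ) / N - (b - a)|} := by
  refine ⟨1, ?_⟩
  rintro d ⟨a, b, ha, hab, hb, rfl⟩
  have hcard : (({n ∈ Finset.Icc 1 N | a < x n ∧ x n < b}.card : ℕ) : ℝ) ≤ N := by
    have h := Finset.card_filter_le (Finset.Icc 1 N) fun n => a < x n ∧ x n < b
    rw [Nat.card_Icc, Nat.add_sub_cancel] at h
    exact_mod_cast h
  have h0 : 0 ≤ (({n ∈ Finset.Icc 1 N | a < x n ∧ x n < b}.card : ℕ) : ℝ) / N := by positivity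
  have h1 : (({n ∈ Finset.Icc 1 N | a < x n ∧ x n < b}.card : ℕ) : ℝ) / N ≤ 1 :=
    div_le_one_of_le₀ hcard (Nat.cast_nonneg N)
  rw [abs_le]
  constructor <;> linarith

theorem discrepancy_nonneg (x : ℕ → ℝ) (N : ℕ) : 0 ≤ discrepancy x N :=
  (abs_nonneg _).trans (le_csSup (discrepancy_bddAbove x N)
    ⟨1 / 3, 2 / 3, by norm_num, by norm_num, by norm_num, rfl⟩)

/-- The lower bound for the number of points in an open interval, extended by continuity to
intervals that reach the end points of `[0, 1]`. -/
theorem le_card_filter_Ioo (x : ℕ → ℝ) {N : ℕ} (hN : 1 ≤ N) {a b : ℝ} (ha : 0 ≤ a) (hb : b ≤ 1) :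
    N * (b - a) - N * discrepancy x N ≤
      (({n ∈ Finset.Icc 1 N | a < x n ∧ x n < b}.card : ℕ) : ℝ) := by
  have hN0 : (0 : ℝ) < N := by exact_mod_cast hN
  have hD := discrepancy_nonneg x N
  refine le_of_forall_pos_le_add fun τ hτ => ?_
  set ρ := τ / (2 * N) with hρ
  have hρ0 : 0 < ρ := by positivity
  have hτρ : τ = N * (2 * ρ) := by rw [hρ]; field_simp
  rcases lt_or_ge (a + ρ) (b - ρ) with hlt | hge
  · have hsup := le_csSup (discrepancy_bddAbove x N)
      ⟨a + ρ, b - ρ, by linarith, hlt, by linarith, rfl⟩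
    change _ ≤ discrepancy x N at hsup
    have hsub : (({n ∈ Finset.Icc 1 N | a + ρ < x n ∧ x n < b - ρ}.card : ℕ) : ℝ) ≤
        (({n ∈ Finset.Icc 1 N | a < x n ∧ x n < b}.card : ℕ) : ℝ) := by
      refine Nat.cast_le.2 (Finset.card_le_card (Finset.monotone_filter_right _ ?_))
      rintro n - ⟨h1, h2⟩
      exact ⟨by linarith, by linarith⟩
    have h1 := (abs_le.1 hsup).1
    have h2 : (b - ρ - (a + ρ)) - discrepancy x N ≤
        (({n ∈ Finset.Icc 1 N | a + ρ < x n ∧ x n < b - ρ}.card : ℕ) : ℝ) / N := by linarith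
    rw [le_div_iff₀ hN0] at h2
    rw [hτρ]
    nlinarith
  · have h0 : (0 : ℝ) ≤ (({n ∈ Finset.Icc 1 N | a < x n ∧ x n < b}.card : ℕ) : ℝ) :=
      Nat.cast_nonneg _
    have h1 : (N : ℝ) * (b - a) ≤ N * (2 * ρ) := by gcongr; linarith
    have h2 : 0 ≤ (N : ℝ) * discrepancy x N := by positivity
    rw [hτρ]
    linarith

theorem windowCount_add_int (x : ℕ → ℝ) (L : ℝ) (N : ℕ) (y : ℝ) (j : ℤ) :
    windowCount x L N (y + j) = windowCount x L N y := by
  classical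
  unfold windowCount
  congr 1
  refine Finset.filter_congr fun n _ => ⟨?_, ?_⟩
  · rintro ⟨m, h1, h2⟩
    exact ⟨m - j, by push_cast; linarith, by push_cast; linarith⟩
  · rintro ⟨m, h1, h2⟩
    exact ⟨m + j, by push_cast; linarith, by push_cast; linarith⟩

theorem card_filter_add_card_filter_le {ι : Type*} (s : Finset ι) {p q r : ι → Prop}
    [DecidablePred p] [DecidablePred q] [DecidablePred r]
    (hpr : ∀ i ∈ s, p i → r i) (hqr : ∀ i ∈ s, q i → r i) (hpq : ∀ i ∈ s, p i → ¬ q i) :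
    (s.filter p).card + (s.filter q).card ≤ (s.filter r).card := by
  classical
  rw [← Finset.card_union_of_disjoint]
  · refine Finset.card_le_card fun i hi => ?_
    simp only [Finset.mem_union, Finset.mem_filter] at hi ⊢
    rcases hi with hi | hi
    exacts [⟨hi.1, hpr i hi.1 hi.2⟩, ⟨hi.1, hqr i hi.1 hi.2⟩]
  · exact Finset.disjoint_filter.2 fun i hi => hpq i hi

/-- Both bounds come from lower bounds for open intervals: a closed arc contains its interior, and
its complement contains at most two open intervals that fill it up to the point `0`. -/
theorem abs_windowCount_sub_le {x : ℕ → ℝ} (hx : ∀ n : ℕ, 1 ≤ n → x n ∈ Set.Ico (0 : ℝ) 1)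
    {N : ℕ} (hN : 1 ≤ N) {L : ℝ} (hL0 : 0 ≤ L) (hLN : L ≤ N) (y : ℝ) :
    |(windowCount x L N y : ℝ) - L| ≤ 2 * (N * discrepancy x N) := by
  classical
  wlog hy : y ∈ Set.Ico (0 : ℝ) 1 generalizing y
  · have h := this (Int.fract y) ⟨Int.fract_nonneg y, Int.fract_lt_one y⟩
    rwa [← windowCount_add_int x L N (Int.fract y) ⌊y⌋, Int.fract_add_floor] at h
  obtain ⟨hy0, hy1⟩ := hy
  have hN0 : (0 : ℝ) < N := by exact_mod_cast hN
  have hD : 0 ≤ N * discrepancy x N := mul_nonneg hN0.le (discrepancy_nonneg x N)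
  set l := L / N with hl
  have hl0 : 0 ≤ l := by positivity
  have hl1 : l ≤ 1 := div_le_one_of_le₀ hLN hN0.le
  have hLl : L = N * l := by rw [hl]; field_simp
  have hI : ∀ n ∈ Finset.Icc 1 N, 0 ≤ x n ∧ x n < 1 := fun n hn => hx n (Finset.mem_Icc.1 hn).1
  -- Counting the points outside the arc.
  have hcompl : (windowCount x L N y : ℝ) + (({n ∈ Finset.Icc 1 N |
      ¬ ∃ m : ℤ, x n + m ∈ Set.Icc y (y + l)}.card : ℕ) : ℝ) = N := by
    have h := Finset.card_filter_add_card_filter_not (s := Finset.Icc 1 N)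
      (fun n => ∃ m : ℤ, x n + m ∈ Set.Icc y (y + l))
    rw [Nat.card_Icc, Nat.add_sub_cancel] at h
    unfold windowCount
    exact_mod_cast h
  have key : ∀ n ∈ Finset.Icc 1 N, (∃ m : ℤ, x n + m ∈ Set.Icc y (y + l)) →
      (y ≤ x n ∧ x n ≤ y + l) ∨ x n ≤ y + l - 1 := by
    rintro n hn ⟨m, h1, h2⟩
    obtain ⟨h3, h4⟩ := hI n hn
    have hm : (-1 : ℝ) < m := by linarith
    have hm' : (m : ℝ) < 2 := by linarith
    have hm1 : -1 < m := by exact_mod_cast hm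
    have hm2 : m < 2 := by exact_mod_cast hm'
    interval_cases m
    · left; push_cast at h1 h2; constructor <;> linarith
    · right; push_cast at h1 h2; linarith
  have in0 : ∀ n ∈ Finset.Icc 1 N, y < x n ∧ x n < min 1 (y + l) →
      ∃ m : ℤ, x n + m ∈ Set.Icc y (y + l) := by
    rintro n hn ⟨h1, h2⟩
    exact ⟨0, by push_cast; linarith, by push_cast; linarith [min_le_right 1 (y + l)]⟩
  have in1 : ∀ n ∈ Finset.Icc 1 N, 0 < x n ∧ x n < y + l - 1 →
      ∃ m : ℤ, x n + m ∈ Set.Icc y (y + l) := by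
    rintro n hn ⟨h1, h2⟩
    exact ⟨1, by push_cast; linarith, by push_cast; linarith⟩
  have A := card_filter_add_card_filter_le (Finset.Icc 1 N) in0 in1 (by
    rintro n hn ⟨h1, h2⟩ ⟨h3, h4⟩
    linarith)
  have B := card_filter_add_card_filter_le (Finset.Icc 1 N)
    (p := fun n => y + l < x n ∧ x n < 1)
    (q := fun n => max 0 (y + l - 1) < x n ∧ x n < y)
    (r := fun n => ¬ ∃ m : ℤ, x n + m ∈ Set.Icc y (y + l))
    (by
      intro n hn h1 h2
      rcases key n hn h2 with h | h
      · linarith [h1.1, h.2]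
      · linarith [h1.1, h1.2])
    (by
      intro n hn h1 h2
      rcases key n hn h2 with h | h
      · linarith [h1.2, h.1]
      · linarith [h1.1, le_max_right 0 (y + l - 1)])
    (by
      intro n hn h1 h2
      linarith [h1.1, h2.2])
  have A' : (({n ∈ Finset.Icc 1 N | y < x n ∧ x n < min 1 (y + l)}.card : ℕ) : ℝ) +
      (({n ∈ Finset.Icc 1 N | 0 < x n ∧ x n < y + l - 1}.card : ℕ) : ℝ) ≤
      (windowCount x L N y : ℝ) := by
    unfold windowCount
    exact_mod_cast A
  have B' : (({n ∈ Finset.Icc 1 N | y + l < x n ∧ x n < 1}.card : ℕ) : ℝ) +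
      (({n ∈ Finset.Icc 1 N | max 0 (y + l - 1) < x n ∧ x n < y}.card : ℕ) : ℝ) ≤
      (({n ∈ Finset.Icc 1 N |
        ¬ ∃ m : ℤ, x n + m ∈ Set.Icc y (y + l)}.card : ℕ) : ℝ) := by
    exact_mod_cast B
  have c1 := le_card_filter_Ioo x hN hy0 (min_le_left 1 (y + l))
  have c2 := le_card_filter_Ioo x hN (a := y + l) (by linarith) le_rfl
  have c3 := le_card_filter_Ioo x hN (le_max_left 0 (y + l - 1)) hy1.le
  rcases le_total (y + l) 1 with h | h
  · rw [min_eq_right h] at A' c1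
    rw [max_eq_left (by linarith)] at B' c3
    rw [abs_le]
    constructor <;> nlinarith
  · have c4 := le_card_filter_Ioo x hN (b := y + l - 1) le_rfl (by linarith)
    rw [min_eq_left h] at A' c1
    rw [max_eq_right (by linarith)] at B' c3
    have c5 : (0 : ℝ) ≤ (({n ∈ Finset.Icc 1 N | y + l < x n ∧ x n < 1}.card : ℕ) : ℝ) :=
      Nat.cast_nonneg _
    rw [abs_le]
    constructor <;> nlinarith

/-- A degenerate arc that consists of one point of the sequence shows `D_N ≫ 1 / N`. -/
theorem one_le_two_mul_mul_discrepancy {x : ℕ → ℝ}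
    (hx : ∀ n : ℕ, 1 ≤ n → x n ∈ Set.Ico (0 : ℝ) 1) {N : ℕ} (hN : 1 ≤ N) :
    1 ≤ 2 * (N * discrepancy x N) := by
  have h := (abs_le.1 (abs_windowCount_sub_le hx hN le_rfl (Nat.cast_nonneg N) (x 1))).2
  have h1 : 1 ≤ windowCount x 0 N (x 1) := by
    classical
    refine Finset.card_pos.2 ⟨1, ?_⟩
    rw [Finset.mem_filter]
    exact ⟨Finset.mem_Icc.2 ⟨le_rfl, hN⟩, 0, by simp⟩
  have h2 : (1 : ℝ) ≤ windowCount x 0 N (x 1) := by exact_mod_cast h1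
  linarith

theorem exponent_le_one_of_discrepancy_le {x : ℕ → ℝ}
    (hx : ∀ n : ℕ, 1 ≤ n → x n ∈ Set.Ico (0 : ℝ) 1) {s C : ℝ}
    (h : ∀ N : ℕ, 1 ≤ N → discrepancy x N ≤ C * (N : ℝ) ^ (-s)) : s ≤ 1 := by
  by_contra! hs
  have hlim : Filter.Tendsto (fun N : ℕ => 2 * C * (N : ℝ) ^ (-(s - 1))) Filter.atTop
      (nhds (2 * C * 0)) :=
    ((tendsto_rpow_neg_atTop (by linarith : 0 < s - 1)).comp
      tendsto_natCast_atTop_atTop).const_mul _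
  rw [mul_zero] at hlim
  obtain ⟨N, hN, hN1⟩ := ((hlim.eventually_lt_const one_pos).and
    (Filter.eventually_ge_atTop 1)).exists
  have hN0 : (0 : ℝ) < N := by exact_mod_cast hN1
  have h1 := one_le_two_mul_mul_discrepancy hx hN1
  have h2 : (N : ℝ) * discrepancy x N ≤ N * (C * (N : ℝ) ^ (-s)) := by gcongr; exact h N hN1
  have h3 : (N : ℝ) ^ (-(s - 1)) = N * (N : ℝ) ^ (-s) := by
    rw [show -(s - 1) = 1 + -s by ring, Real.rpow_add hN0, Real.rpow_one]
  rw [h3] at hN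
  nlinarith

/-! ### Moments of the window count -/

theorem measurable_windowCount (x : ℕ → ℝ) (L : ℝ) (N : ℕ) :
    Measurable fun y => (windowCount x L N y : ℝ) := by
  classical
  have h : (fun y => (windowCount x L N y : ℝ)) = fun y => ∑ n ∈ Finset.Icc 1 N,
      (⋃ m : ℤ, Set.Icc (x n + m - L / N) (x n + m)).indicator (fun _ => (1 : ℝ)) y := by
    funext y
    unfold windowCount
    rw [Finset.card_filter, Nat.cast_sum]
    refine Finset.sum_congr rfl fun n _ => ?_
    rw [Set.indicator_apply, Nat.cast_ite, Nat.cast_one, Nat.cast_zero]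
    refine if_congr ?_ rfl rfl
    rw [Set.mem_iUnion]
    refine exists_congr fun m => ⟨fun h => ⟨?_, h.1⟩, fun h => ⟨h.2, ?_⟩⟩
    · linarith [h.2]
    · linarith [h.1]
  rw [h]
  refine Finset.measurable_sum _ fun n _ => measurable_const.indicator ?_
  exact MeasurableSet.iUnion fun m => measurableSet_Icc

theorem windowCount_le (x : ℕ → ℝ) (L : ℝ) (N : ℕ) (y : ℝ) : windowCount x L N y ≤ N := by
  classical
  refine (Finset.card_filter_le _ _).trans ?_
  simp

theorem abs_windowMoment_sub_le {x : ℕ → ℝ} {L : ℝ} {N k : ℕ} {E : ℝ}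
    (h : ∀ y, |(windowCount x L N y : ℝ) ^ k - L ^ k| ≤ E) : |windowMoment x L N k - L ^ k| ≤ E := by
  have hint : IntegrableOn (fun y => (windowCount x L N y : ℝ) ^ k) (Set.Ico 0 1) := by
    refine Measure.integrableOn_of_bounded (M := (N : ℝ) ^ k) (by simp)
      ((measurable_windowCount x L N).pow_const k).aestronglyMeasurable (ae_of_all _ fun y => ?_)
    rw [norm_pow, Real.norm_natCast]
    gcongr
    exact windowCount_le x L N y
  have hc : ∫ _ in Set.Ico (0 : ℝ) 1, L ^ k = L ^ k := by simp
  have hs : windowMoment x L N k - L ^ k =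
      ∫ y in Set.Ico (0 : ℝ) 1, ((windowCount x L N y : ℝ) ^ k - L ^ k) := by
    rw [integral_sub hint (by simp), hc, windowMoment]
  rw [hs, ← Real.norm_eq_abs]
  refine (norm_setIntegral_le_of_norm_le_const (C := E) (by simp) fun y _ => h y).trans ?_
  simp

/-- A relative error `θ` in the base is a relative error of at most `k θ (1 + θ) ^ (k - 1)` in the
`k`-th power. -/
theorem abs_pow_sub_pow_le_of_abs_sub_le {W L θ : ℝ} (hW : 0 ≤ W) (hL : 0 ≤ L) (hθ : 0 ≤ θ)
    (h : |W - L| ≤ θ * L) {k : ℕ} (hk : 1 ≤ k) :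
    |W ^ k - L ^ k| ≤ k * θ * (1 + θ) ^ (k - 1) * L ^ k := by
  have hmax : max |W| |L| ≤ (1 + θ) * L := by
    rw [abs_of_nonneg hW, abs_of_nonneg hL]
    refine max_le ?_ ?_
    · linarith [(abs_le.1 h).2]
    · nlinarith
  calc |W ^ k - L ^ k| ≤ |W - L| * k * max |W| |L| ^ (k - 1) := abs_pow_sub_pow_le ..
    _ ≤ (θ * L) * k * ((1 + θ) * L) ^ (k - 1) := by gcongr
    _ = k * θ * (1 + θ) ^ (k - 1) * (L ^ (k - 1) * L) := by rw [mul_pow]; ring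
    _ = k * θ * (1 + θ) ^ (k - 1) * L ^ k := by
      rw [← pow_succ, Nat.sub_add_cancel hk]

theorem rpow_add_half_le {β ε L : ℝ} {N : ℕ} (hN : 1 ≤ N) (hL : (N : ℝ) ^ (β + ε) < L) :
    (N : ℝ) ^ (β + ε / 2) ≤ (N : ℝ) ^ (-ε / 2) * L := by
  have hN0 : (0 : ℝ) < N := by exact_mod_cast hN
  rw [show β + ε / 2 = -ε / 2 + (β + ε) by ring, Real.rpow_add hN0]
  gcongr

theorem momentEstimate_of_abs_windowCount_sub_le {x : ℕ → ℝ} {β ε C : ℝ} (hε : 0 < ε) (hC : 0 ≤ C)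
    (hW : ∀ N : ℕ, 1 ≤ N → ∀ L : ℝ, 0 ≤ L → L ≤ N → ∀ y,
      |(windowCount x L N y : ℝ) - L| ≤ C * (N : ℝ) ^ (β + ε / 2)) : MomentEstimate x β ε := by
  have key : ∀ k : ℕ, 2 ≤ k → ∀ N : ℕ, 1 ≤ N → ∀ L : ℝ, (N : ℝ) ^ (β + ε) < L → L ≤ N →
      |windowMoment x L N k - L ^ k| ≤ k * (C * (N : ℝ) ^ (-ε / 2)) *
        (1 + C * (N : ℝ) ^ (-ε / 2)) ^ (k - 1) * L ^ k := by
    intro k hk N hN L hL hLN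
    have hL0 : 0 ≤ L := (Real.rpow_nonneg (Nat.cast_nonneg N) _).trans hL.le
    refine abs_windowMoment_sub_le fun y => ?_
    refine abs_pow_sub_pow_le_of_abs_sub_le (Nat.cast_nonneg _) hL0 (by positivity) ?_ (by omega)
    refine (hW N hN L hL0 hLN y).trans ?_
    rw [mul_assoc]
    gcongr
    exact rpow_add_half_le hN hL
  constructor
  · refine ⟨C * Real.exp C, fun k hk N hN hkN L hL hLN => (key k hk N hN L hL hLN).trans ?_⟩
    have hL0 : 0 ≤ L := (Real.rpow_nonneg (Nat.cast_nonneg N) _).trans hL.le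
    set δ := (N : ℝ) ^ (-ε / 2)
    have hδ : 0 ≤ δ := by positivity
    have h1 : (1 + C * δ) ^ (k - 1) ≤ Real.exp C := by
      calc (1 + C * δ) ^ (k - 1) ≤ (1 + C * δ) ^ k :=
            pow_le_pow_right₀ (by nlinarith) (Nat.sub_le k 1)
        _ ≤ Real.exp (C * δ) ^ k := by
            gcongr
            rw [add_comm]
            exact Real.add_one_le_exp _
        _ = Real.exp (C * (k * δ)) := by rw [← Real.exp_nat_mul]; ring_nf
        _ ≤ Real.exp C := by
            refine Real.exp_le_exp.2 ?_
            nlinarith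
    calc k * (C * δ) * (1 + C * δ) ^ (k - 1) * L ^ k ≤ k * (C * δ) * Real.exp C * L ^ k := by gcongr
      _ = C * Real.exp C * (k * δ) * L ^ k := by ring
  · refine fun k hk => ⟨C * (1 + C) ^ (k - 1), fun N hN L hL hLN =>
      (key k hk N hN L hL hLN).trans ?_⟩
    have hL0 : 0 ≤ L := (Real.rpow_nonneg (Nat.cast_nonneg N) _).trans hL.le
    have hδ1 : (N : ℝ) ^ (-ε / 2) ≤ 1 :=
      Real.rpow_le_one_of_one_le_of_nonpos (by exact_mod_cast hN) (by linarith)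
    set δ := (N : ℝ) ^ (-ε / 2)
    have hδ : 0 ≤ δ := by positivity
    calc k * (C * δ) * (1 + C * δ) ^ (k - 1) * L ^ k ≤
          k * (C * δ) * (1 + C * 1) ^ (k - 1) * L ^ k := by gcongr
      _ = C * (1 + C) ^ (k - 1) * (k * δ) * L ^ k := by ring

/-! ### Sums over the points near a given point -/

theorem sgnDist_mem_Icc_iff {z a b : ℝ} (ha : -(1 / 2) < a) (hb : b < 1 / 2) :
    sgnDist z ∈ Set.Icc a b ↔ ∃ m : ℤ, z + m ∈ Set.Icc a b := by
  constructor
  · intro h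
    refine ⟨-⌈z - 1 / 2⌉, ?_⟩
    rw [Int.cast_neg, ← sub_eq_add_neg]
    exact h
  · rintro ⟨m, h⟩
    have hm : ⌈z - 1 / 2⌉ = -m := by
      rw [Int.ceil_eq_iff]
      push_cast
      constructor <;> linarith [h.1, h.2]
    rw [sgnDist, hm, Int.cast_neg, sub_neg_eq_add]
    exact h

/-- In the rescaled local coordinate `N / L * sgnDist (x n - y)` around `y`, the points that fall
into a short interval are those that lie in an arc. -/
theorem card_filter_sgnDist_eq_windowCount (x : ℕ → ℝ) {L : ℝ} {N : ℕ} (hN : 1 ≤ N) (hL : 0 < L)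
    (y : ℝ) {t h R : ℝ} (hR : R * L < N / 2) (ht : -R ≤ t) (hth : t + h ≤ R) :
    {n ∈ Finset.Icc 1 N | N / L * sgnDist (x n - y) ∈ Set.Icc t (t + h)}.card =
      windowCount x (h * L) N (y + t * L / N) := by
  classical
  have hN0 : (0 : ℝ) < N := by exact_mod_cast hN
  unfold windowCount
  congr 1
  refine Finset.filter_congr fun n _ => ?_
  have h1 : N / L * sgnDist (x n - y) ∈ Set.Icc t (t + h) ↔
      sgnDist (x n - y) ∈ Set.Icc (t * L / N) ((t + h) * L / N) := by
    rw [Set.mem_Icc, Set.mem_Icc, div_le_iff₀ hN0, le_div_iff₀ hN0, div_mul_eq_mul_div,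
      le_div_iff₀ hL, div_le_iff₀ hL, mul_comm (sgnDist _)]
  have hlow : -(1 / 2) < t * L / N := by
    rw [lt_div_iff₀ hN0]
    nlinarith
  have hup : (t + h) * L / N < 1 / 2 := by
    rw [div_lt_iff₀ hN0]
    nlinarith
  rw [h1, sgnDist_mem_Icc_iff hlow hup]
  refine exists_congr fun m => ?_
  have h2 : y + t * L / N + h * L / N = y + (t + h) * L / N := by ring
  rw [h2, Set.mem_Icc, Set.mem_Icc]
  constructor <;> rintro ⟨h3, h4⟩ <;> constructor <;> linarith

/-- Averaging the value of a compactly supported function over an interval of length `h` to the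
left of `u`. -/
theorem abs_mul_sub_setIntegral_le {f : ℝ → ℝ} (hf : Continuous f) {M h η : ℝ}
    (hM : ∀ t, M < |t| → f t = 0) (hh : 0 ≤ h) (hosc : ∀ s t, |s - t| ≤ h → |f s - f t| ≤ η)
    (u : ℝ) : |h * f u - ∫ t in Set.Icc (u - h) u, f t| ≤
      if u ∈ Set.Icc (-(M + h)) (M + h) then η * h else 0 := by
  have hcst : ∫ _ in Set.Icc (u - h) u, f u = h * f u := by
    simp [hh]
  split_ifs with hu
  · have hfi : IntegrableOn f (Set.Icc (u - h) u) :=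
      hf.continuousOn.integrableOn_compact isCompact_Icc
    rw [← hcst, ← integral_sub (by simp) hfi, ← Real.norm_eq_abs]
    refine (norm_setIntegral_le_of_norm_le_const (C := η) (by simp) fun t ht => ?_).trans ?_
    · refine hosc u t ?_
      rw [abs_le]
      constructor <;> linarith [ht.1, ht.2]
    · simp [hh]
  · have hu' : M + h < |u| := by
      by_contra! hc
      exact hu (abs_le.1 hc)
    have h0 : ∀ t ∈ Set.Icc (u - h) u, f t = 0 := by
      intro t ht
      refine hM t ?_
      rcases lt_abs.1 hu' with hc | hc
      · exact lt_abs.2 (Or.inl (by linarith [ht.1]))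
      · exact lt_abs.2 (Or.inr (by linarith [ht.2]))
    rw [setIntegral_congr_fun measurableSet_Icc h0, hM u (by linarith)]
    simp

/-- Equidistribution of the points in short arcs, with error at most `E`, makes a sum of a
compactly supported function over the rescaled local coordinates close to its integral. The sum is
replaced by its average over the translates of a short interval, and this average is an integral
against counts of points in arcs. -/
theorem abs_mul_sum_sub_le (x : ℕ → ℝ) {L : ℝ} {N : ℕ} (hN : 1 ≤ N) (hL : 0 < L) {E : ℝ}
    (hW : ∀ L' : ℝ, 0 ≤ L' → L' ≤ N → ∀ y, |(windowCount x L' N y : ℝ) - L'| ≤ E)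
    {f : ℝ → ℝ} (hf : Continuous f) {M B h η : ℝ} (hM0 : 0 ≤ M) (hM : ∀ t, M < |t| → f t = 0)
    (hB : ∀ t, |f t| ≤ B) (hh : 0 ≤ h) (hη : 0 ≤ η)
    (hosc : ∀ s t, |s - t| ≤ h → |f s - f t| ≤ η) (hR : (M + h) * L < N / 2) (y : ℝ) :
    |h * ∑ n ∈ Finset.Icc 1 N, f (N / L * sgnDist (x n - y)) - h * L * ∫ t, f t| ≤
      η * h * (2 * (M + h) * L + E) + E * (B * (2 * M)) := by
  classical
  have hE : 0 ≤ E := (abs_nonneg _).trans (hW 0 le_rfl (Nat.cast_nonneg N) 0)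
  set u : ℕ → ℝ := fun n => N / L * sgnDist (x n - y) with hu
  have hfz : ∀ t, t ∉ Set.Icc (-M) M → f t = 0 := fun t ht => hM t (by
    by_contra! hc
    exact ht (abs_le.1 hc))
  have hfI : Integrable f := hf.integrable_of_hasCompactSupport
    (HasCompactSupport.intro isCompact_Icc hfz)
  -- Replacing each value by its average.
  have h1 : |h * ∑ n ∈ Finset.Icc 1 N, f (u n) -
      ∑ n ∈ Finset.Icc 1 N, ∫ t in Set.Icc (u n - h) (u n), f t| ≤
      η * h * (2 * (M + h) * L + E) := by
    rw [Finset.mul_sum, ← Finset.sum_sub_distrib]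
    calc _ ≤ ∑ n ∈ Finset.Icc 1 N, |h * f (u n) - ∫ t in Set.Icc (u n - h) (u n), f t| :=
          Finset.abs_sum_le_sum_abs _ _
      _ ≤ ∑ n ∈ Finset.Icc 1 N, if u n ∈ Set.Icc (-(M + h)) (M + h) then η * h else 0 :=
          Finset.sum_le_sum fun n _ => abs_mul_sub_setIntegral_le hf hM hh hosc (u n)
      _ = η * h * ({n ∈ Finset.Icc 1 N | u n ∈ Set.Icc (-(M + h)) (M + h)}.card : ℕ) := by
          rw [← Finset.sum_filter, Finset.sum_const, nsmul_eq_mul, mul_comm]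
      _ ≤ η * h * (2 * (M + h) * L + E) := by
          have hc := card_filter_sgnDist_eq_windowCount x hN hL y (t := -(M + h))
            (h := 2 * (M + h)) hR le_rfl (by linarith)
          rw [show -(M + h) + 2 * (M + h) = M + h by ring] at hc
          rw [hc]
          have hw := (abs_le.1 (hW (2 * (M + h) * L) (by positivity) (by linarith)
            (y + -(M + h) * L / N))).2
          gcongr
          linarith
  have h2 : ∑ n ∈ Finset.Icc 1 N, ∫ t in Set.Icc (u n - h) (u n), f t =
      ∫ t, f t * (windowCount x (h * L) N (y + t * L / N) : ℝ) := by
    have h3 : ∀ n ∈ Finset.Icc 1 N, ∫ t in Set.Icc (u n - h) (u n), f t =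
        ∫ t, (Set.Icc (u n - h) (u n)).indicator f t := fun n _ =>
      (integral_indicator measurableSet_Icc).symm
    rw [Finset.sum_congr rfl h3, ← integral_finsetSum _ fun n _ =>
      hfI.indicator measurableSet_Icc]
    refine integral_congr_ae (ae_of_all _ fun t => ?_)
    change ∑ n ∈ Finset.Icc 1 N, (Set.Icc (u n - h) (u n)).indicator f t =
      f t * (windowCount x (h * L) N (y + t * L / N) : ℝ)
    by_cases ht : t ∈ Set.Icc (-M) M
    · rw [← card_filter_sgnDist_eq_windowCount x hN hL y hR (by linarith [ht.1])
        (by linarith [ht.2]), mul_comm, ← nsmul_eq_mul, ← Finset.sum_const, Finset.sum_filter]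
      refine Finset.sum_congr rfl fun n _ => ?_
      rw [Set.indicator_apply]
      refine if_congr ?_ rfl rfl
      rw [Set.mem_Icc, Set.mem_Icc]
      constructor <;> rintro ⟨h4, h5⟩ <;> constructor <;> linarith
    · rw [hfz t ht, zero_mul]
      refine Finset.sum_eq_zero fun n _ => ?_
      rw [Set.indicator_apply, hfz t ht, ite_self]
  have h3 : |(∫ t, f t * (windowCount x (h * L) N (y + t * L / N) : ℝ)) - h * L * ∫ t, f t| ≤
      E * (B * (2 * M)) := by
    have hmeas : Measurable fun t => (windowCount x (h * L) N (y + t * L / N) : ℝ) :=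
      (measurable_windowCount x (h * L) N).comp (by fun_prop)
    have hI : Integrable fun t => f t * (windowCount x (h * L) N (y + t * L / N) : ℝ) := by
      refine hfI.mul_bdd (c := N) hmeas.aestronglyMeasurable (ae_of_all _ fun t => ?_)
      rw [Real.norm_natCast]
      exact_mod_cast windowCount_le x (h * L) N _
    have h4 : (∫ t, f t * (windowCount x (h * L) N (y + t * L / N) : ℝ)) - h * L * ∫ t, f t =
        ∫ t in Set.Icc (-M) M,
          f t * ((windowCount x (h * L) N (y + t * L / N) : ℝ) - h * L) := by
      rw [setIntegral_eq_integral_of_forall_compl_eq_zero fun t ht => by rw [hfz t ht, zero_mul],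
        ← integral_const_mul, ← integral_sub hI (hfI.const_mul _)]
      exact integral_congr_ae (ae_of_all _ fun t => by ring)
    rw [h4, ← Real.norm_eq_abs]
    refine (norm_setIntegral_le_of_norm_le_const (C := B * E) (by simp) fun t ht => ?_).trans ?_
    · rw [norm_mul, Real.norm_eq_abs, Real.norm_eq_abs]
      have hhL : h * L ≤ N := by nlinarith
      have hB0 : 0 ≤ B := (abs_nonneg _).trans (hB t)
      gcongr
      · exact hB t
      · exact hW _ (by positivity) hhL _
    · rw [Real.volume_real_Icc_of_le (by linarith)]
      apply le_of_eq
      ring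
  rw [h2] at h1
  exact (abs_sub_le _ _ _).trans (add_le_add h1 h3)

/-! ### Sums over tuples of distinct indices -/

/-- The estimate `abs_mul_sum_sub_le` as `N → ∞` for an equicontinuous family of functions,
uniformly in the family, the centre `y`, the range of `L`, and the choice of boundedly many omitted
indices. -/
theorem exists_forall_abs_sum_sub_le {x : ℕ → ℝ} {β ε C : ℝ} (hβ : 0 ≤ β) (hε : 0 < ε) (hC : 0 ≤ C)
    (hW : ∀ N : ℕ, 1 ≤ N → ∀ L : ℝ, 0 ≤ L → L ≤ N → ∀ y,
      |(windowCount x L N y : ℝ) - L| ≤ C * (N : ℝ) ^ (β + ε / 2))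
    {ι : Type*} {f : ι → ℝ → ℝ} (hf : ∀ i, Continuous (f i)) {M B : ℝ} (hM0 : 0 ≤ M) (hB0 : 0 ≤ B)
    (hM : ∀ i t, M < |t| → f i t = 0) (hB : ∀ i t, |f i t| ≤ B)
    (hosc : ∀ η > 0, ∃ h > 0, ∀ i s t, |s - t| ≤ h → |f i s - f i t| ≤ η)
    (J : ℕ) {κ : ℝ} (hκ : 0 < κ) :
    ∃ N₀ : ℕ, ∀ N : ℕ, N₀ ≤ N → ∀ L : ℝ, (N : ℝ) ^ (β + ε) < L → L < (N : ℝ) ^ (1 - ε) →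
      ∀ i y (s : Finset ℕ), s.card ≤ J →
        |∑ a ∈ Finset.Icc 1 N \ s, f i (N / L * sgnDist (x a - y)) - L * ∫ t, f i t| ≤ κ * L := by
  -- An arc of radius `(M + 1) L / N` contains at most `(2 (M + 1) + C) L` points, so that this
  -- oscillation contributes at most `κ L / 4`.
  obtain ⟨h', hh', hosc'⟩ := hosc (κ / (4 * (2 * (M + 1) + C))) (by positivity)
  set h := min h' 1 with hh_def
  have hh : 0 < h := lt_min hh' one_pos
  have hh1 : h ≤ 1 := min_le_right _ _
  have hposc : ∀ i s t, |s - t| ≤ h → |f i s - f i t| ≤ κ / (4 * (2 * (M + 1) + C)) :=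
    fun i s t hst => hosc' i s t (hst.trans (min_le_left _ _))
  have hcast := tendsto_natCast_atTop_atTop (R := ℝ)
  have hneg : ∀ e : ℝ, 0 < e → Filter.Tendsto (fun N : ℕ => (N : ℝ) ^ (-e)) Filter.atTop (nhds 0) :=
    fun e he => (tendsto_rpow_neg_atTop he).comp hcast
  have e1 : ∀ᶠ N : ℕ in Filter.atTop, J * B * (4 / κ) ≤ (N : ℝ) ^ ε :=
    ((tendsto_rpow_atTop hε).comp hcast).eventually_ge_atTop _
  have e2 : ∀ᶠ N : ℕ in Filter.atTop, (N : ℝ) ^ (-ε) < 1 / (2 * (M + 1)) :=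
    (hneg ε hε).eventually_lt_const (by positivity)
  have e3 : ∀ᶠ N : ℕ in Filter.atTop, (N : ℝ) ^ (-(ε / 2)) < κ / 4 * h / (C * (B * (2 * M)) + 1) :=
    (hneg (ε / 2) (by positivity)).eventually_lt_const (by positivity)
  obtain ⟨N₀, hN₀⟩ := Filter.eventually_atTop.1
    (((e1.and e2).and e3).and (Filter.eventually_ge_atTop 1))
  refine ⟨N₀, fun N hN L hL hLu i y s hs => ?_⟩
  obtain ⟨⟨⟨h1, h2⟩, h3⟩, hN1⟩ := hN₀ N hN
  have hN0 : (0 : ℝ) < N := by exact_mod_cast hN1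
  have hN1' : (1 : ℝ) ≤ N := by exact_mod_cast hN1
  have hL0 : 0 < L := (Real.rpow_pos_of_pos hN0 _).trans hL
  have hLε : (N : ℝ) ^ ε ≤ L :=
    (Real.rpow_le_rpow_of_exponent_le hN1' (by linarith)).trans hL.le
  have hE := rpow_add_half_le hN1 hL
  have hδ1 : (N : ℝ) ^ (-ε / 2) ≤ 1 := Real.rpow_le_one_of_one_le_of_nonpos hN1' (by linarith)
  have hLN : (M + h) * L < N / 2 := by
    rw [sub_eq_add_neg, Real.rpow_add hN0, Real.rpow_one] at hLu
    rw [lt_div_iff₀ (by positivity)] at h2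
    calc (M + h) * L ≤ (M + 1) * L := by gcongr
      _ < (M + 1) * (N * (N : ℝ) ^ (-ε)) := by gcongr
      _ ≤ N / 2 := by nlinarith
  have main := abs_mul_sum_sub_le x hN1 hL0 (hW N hN1) (hf i) hM0 (hM i) (hB i) hh.le
    (by positivity) (hposc i) hLN y
  rw [neg_div] at hE hδ1
  rw [lt_div_iff₀ (by positivity)] at h3
  set δ := (N : ℝ) ^ (-(ε / 2)) with hδ
  have hδ0 : 0 ≤ δ := by positivity
  have hE1 : C * (N : ℝ) ^ (β + ε / 2) ≤ C * (δ * L) := by gcongr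
  have b1 : κ / (4 * (2 * (M + 1) + C)) * h *
      (2 * (M + h) * L + C * (N : ℝ) ^ (β + ε / 2)) ≤ κ / 4 * (h * L) := by
    have hle : 2 * (M + h) * L + C * (N : ℝ) ^ (β + ε / 2) ≤ (2 * (M + 1) + C) * L := by
      have : C * (δ * L) ≤ C * (1 * L) := by gcongr
      nlinarith
    calc _ ≤ κ / (4 * (2 * (M + 1) + C)) * h * ((2 * (M + 1) + C) * L) := by gcongr
      _ = κ / 4 * (h * L) := by field_simp
  have b2 : C * (N : ℝ) ^ (β + ε / 2) * (B * (2 * M)) ≤ κ / 4 * (h * L) := by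
    calc _ ≤ C * (δ * L) * (B * (2 * M)) := by gcongr
      _ = δ * (C * (B * (2 * M))) * L := by ring
      _ ≤ κ / 4 * h * L := mul_le_mul_of_nonneg_right (by linarith) hL0.le
      _ = κ / 4 * (h * L) := by ring
  have b3 : |∑ a ∈ Finset.Icc 1 N, f i (N / L * sgnDist (x a - y)) - L * ∫ t, f i t| ≤
      κ / 2 * L := by
    rw [mul_assoc, ← mul_sub, abs_mul, abs_of_pos hh] at main
    refine le_of_mul_le_mul_left ?_ hh
    linarith
  have b4 : |∑ a ∈ Finset.Icc 1 N ∩ s, f i (N / L * sgnDist (x a - y))| ≤ κ / 4 * L := by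
    calc _ ≤ ∑ a ∈ Finset.Icc 1 N ∩ s, |f i (N / L * sgnDist (x a - y))| :=
          Finset.abs_sum_le_sum_abs _ _
      _ ≤ (Finset.Icc 1 N ∩ s).card • B := Finset.sum_le_card_nsmul _ _ _ fun a _ => hB i _
      _ ≤ J * B := by
          rw [nsmul_eq_mul]
          gcongr
          exact (Finset.card_le_card Finset.inter_subset_right).trans hs
      _ = κ / 4 * (J * B * (4 / κ)) := by field_simp
      _ ≤ κ / 4 * L := by gcongr; exact h1.trans hLε
  have hsplit := Finset.sum_inter_add_sum_sdiff (Finset.Icc 1 N) s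
    fun a => f i (N / L * sgnDist (x a - y))
  rw [← hsplit] at b3
  rw [abs_le] at b3 b4 ⊢
  have : 0 < κ * L := by positivity
  constructor <;> linarith [b3.1, b3.2, b4.1, b4.2]

/-- The rescaled signed distances between consecutive members of a tuple of points. -/
def scaledDiff (x : ℕ → ℝ) (L : ℝ) (N : ℕ) {d : ℕ} (n : Fin (d + 1) → ℕ) : Fin d → ℝ :=
  fun i => N / L * sgnDist (x (n i.castSucc) - x (n i.succ))

/-- The set of `d`-tuples of pairwise distinct indices in `{1, …, N}`. -/
def distinctTuples (N d : ℕ) : Finset (Fin d → ℕ) := by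
  classical exact {n ∈ Fintype.piFinset fun _ : Fin d => Finset.Icc 1 N | Function.Injective n}

theorem mem_distinctTuples {N d : ℕ} {n : Fin d → ℕ} :
    n ∈ distinctTuples N d ↔ (∀ i, n i ∈ Finset.Icc 1 N) ∧ Function.Injective n := by
  classical
  rw [distinctTuples, Finset.mem_filter, Fintype.mem_piFinset]

theorem scaledDiff_cons (x : ℕ → ℝ) (L : ℝ) (N : ℕ) {d : ℕ} (a : ℕ) (n : Fin (d + 1) → ℕ) :
    scaledDiff x L N (Fin.cons a n : Fin (d + 2) → ℕ) =
      Fin.cons (N / L * sgnDist (x a - x (n 0))) (scaledDiff x L N n) := by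
  funext i
  refine Fin.cases ?_ (fun j => ?_) i
  · simp [scaledDiff]
  · simp [scaledDiff]

theorem sum_distinctTuples_succ {N d : ℕ} (F : (Fin (d + 1) → ℕ) → ℝ) :
    ∑ n ∈ distinctTuples N (d + 1), F n = ∑ n ∈ distinctTuples N d,
      ∑ a ∈ Finset.Icc 1 N \ Finset.univ.image n, F (Fin.cons a n) := by
  rw [Finset.sum_sigma']
  refine Finset.sum_bij' (fun m _ => ⟨Fin.tail m, m 0⟩) (fun p _ => Fin.cons p.2 p.1) ?_ ?_ ?_ ?_ ?_
  · intro m hm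
    obtain ⟨h1, h2⟩ := mem_distinctTuples.1 hm
    rw [Finset.mem_sigma, mem_distinctTuples, Finset.mem_sdiff]
    rw [← Fin.cons_self_tail m, Fin.cons_injective_iff] at h2
    exact ⟨⟨fun i => h1 _, h2.2⟩, h1 0, by simpa using h2.1⟩
  · rintro ⟨n, a⟩ hp
    rw [Finset.mem_sigma, mem_distinctTuples, Finset.mem_sdiff] at hp
    rw [mem_distinctTuples, Fin.cons_injective_iff]
    refine ⟨fun i => ?_, by simpa using hp.2.2, hp.1.2⟩
    refine Fin.cases ?_ (fun j => ?_) i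
    · simpa using hp.2.1
    · simpa using hp.1.1 j
  · intro m _
    exact Fin.cons_self_tail m
  · rintro ⟨n, a⟩ _
    simp
  · intro m _
    simp

theorem integral_fin_succ {d : ℕ} {g : (Fin (d + 1) → ℝ) → ℝ} (hg : Integrable g) :
    ∫ w, g w = ∫ w : Fin d → ℝ, ∫ t : ℝ, g (Fin.cons t w) := by
  have hmp := (volume_preserving_piFinSuccAbove (fun _ : Fin (d + 1) => ℝ) 0).symm
  have hint := (hmp.integrable_comp_emb (MeasurableEquiv.measurableEmbedding _)).2 hg
  rw [← hmp.integral_comp (MeasurableEquiv.measurableEmbedding _) g]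
  refine (integral_prod_symm _ hint).trans ?_
  simp [MeasurableEquiv.piFinSuccAbove_symm_apply, Fin.insertNthEquiv]

theorem abs_le_norm_cons {d : ℕ} (t : ℝ) (w : Fin d → ℝ) :
    |t| ≤ ‖(Fin.cons t w : Fin (d + 1) → ℝ)‖ := by
  simpa using norm_le_pi_norm (Fin.cons t w : Fin (d + 1) → ℝ) 0

theorem norm_le_norm_cons {d : ℕ} (t : ℝ) (w : Fin d → ℝ) :
    ‖w‖ ≤ ‖(Fin.cons t w : Fin (d + 1) → ℝ)‖ := by
  refine (pi_norm_le_iff_of_nonneg (norm_nonneg _)).2 fun i => ?_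
  simpa using norm_le_pi_norm (Fin.cons t w : Fin (d + 1) → ℝ) i.succ

theorem dist_cons_cons {d : ℕ} (s t : ℝ) (w : Fin d → ℝ) :
    dist (Fin.cons s w : Fin (d + 1) → ℝ) (Fin.cons t w) ≤ |s - t| := by
  refine (dist_pi_le_iff (abs_nonneg _)).2 fun i => ?_
  refine Fin.cases ?_ (fun j => ?_) i
  · simp [Real.dist_eq]
  · simp

theorem continuous_cons_right {d : ℕ} :
    Continuous fun p : (Fin d → ℝ) × ℝ => (Fin.cons p.2 p.1 : Fin (d + 1) → ℝ) := by
  refine continuous_pi fun i => ?_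
  refine Fin.cases ?_ (fun j => ?_) i
  · simpa using continuous_snd
  · simpa using! (continuous_apply j).comp continuous_fst

/-! ### Correlations -/

theorem exists_norm_bound_of_hasCompactSupport {d : ℕ} {g : (Fin d → ℝ) → ℝ}
    (hg : HasCompactSupport g) : ∃ M : ℝ, 0 ≤ M ∧ ∀ w, M < ‖w‖ → g w = 0 := by
  obtain ⟨M, hM⟩ := hg.isBounded.exists_norm_le
  refine ⟨max M 0, le_max_right _ _, fun w hw => image_eq_zero_of_notMem_tsupport fun hc => ?_⟩
  exact (hM w hc).not_gt ((le_max_left _ _).trans_lt hw)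

/-- The correlation asymptotics for signed test functions, by induction on the number of
variables. The index that occurs only in the first variable of `g` is summed first. The other
indices being fixed, this sum is `L` times the integral of `g` over its first variable, up to an
error of `o(L)`; this error is non-zero only where a fixed compactly supported function `χ` of the
remaining variables is at least `1`, so that its total is controlled by the induction hypothesis
for `χ`. -/
theorem exists_forall_abs_sum_distinctTuples_sub_le {x : ℕ → ℝ} {β ε C : ℝ} (hβ : 0 ≤ β)
    (hε : 0 < ε) (hC : 0 ≤ C)
    (hW : ∀ N : ℕ, 1 ≤ N → ∀ L : ℝ, 0 ≤ L → L ≤ N → ∀ y,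
      |(windowCount x L N y : ℝ) - L| ≤ C * (N : ℝ) ^ (β + ε / 2)) (d : ℕ) :
    ∀ g : (Fin d → ℝ) → ℝ, Continuous g → HasCompactSupport g → ∀ η : ℝ, 0 < η →
      ∃ N₀ : ℕ, ∀ N : ℕ, N₀ ≤ N → ∀ L : ℝ, (N : ℝ) ^ (β + ε) < L → L < (N : ℝ) ^ (1 - ε) →
        |∑ n ∈ distinctTuples N (d + 1), g (scaledDiff x L N n) - N * L ^ d * ∫ w, g w| ≤
          η * (N * L ^ d) := by
  induction d with
  | zero =>
    intro g _ _ η hη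
    refine ⟨0, fun N _ L _ _ => ?_⟩
    have hg : ∀ w, g w = g 0 := fun w => by rw [Subsingleton.elim w 0]
    have hI : ∫ w : Fin 0 → ℝ, g w = g 0 := by simp [hg, measureReal_def, volume_pi]
    have hcard : (distinctTuples N 1).card = N := by
      have h : distinctTuples N 1 = Fintype.piFinset fun _ : Fin 1 => Finset.Icc 1 N := by
        ext n
        rw [mem_distinctTuples, Fintype.mem_piFinset, and_iff_left_iff_imp]
        exact fun _ => Function.injective_of_subsingleton n
      rw [h, Fintype.card_piFinset]
      simp
    rw [hI, Finset.sum_congr rfl fun n _ => hg (scaledDiff x L N n), Finset.sum_const, hcard,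
      nsmul_eq_mul, pow_zero, mul_one, sub_self, abs_zero]
    positivity
  | succ d ih =>
    intro g hgc hgs η hη
    obtain ⟨M, hM0, hM⟩ := exists_norm_bound_of_hasCompactSupport hgs
    obtain ⟨B, hB⟩ := hgc.bounded_above_of_compact_support hgs
    have hB0 : 0 ≤ B := (norm_nonneg _).trans (hB 0)
    have hu : UniformContinuous g := hgs.uniformContinuous_of_continuous hgc
    have hzero : ∀ t : ℝ, ∀ w : Fin d → ℝ, M < ‖w‖ → g (Fin.cons t w) = 0 :=
      fun t w hw => hM _ (hw.trans_le (norm_le_norm_cons t w))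
    have hzero' : ∀ (w : Fin d → ℝ) (t : ℝ), M < |t| → g (Fin.cons t w) = 0 :=
      fun w t ht => hM _ (ht.trans_le (abs_le_norm_cons t w))
    have hosc : ∀ η > 0, ∃ h > 0, ∀ (w : Fin d → ℝ) (s t : ℝ), |s - t| ≤ h →
        |g (Fin.cons s w) - g (Fin.cons t w)| ≤ η := by
      intro η hη
      obtain ⟨δ, hδ, h⟩ := Metric.uniformContinuous_iff.1 hu η hη
      refine ⟨δ / 2, half_pos hδ, fun w s t hst => ?_⟩
      have := h ((dist_cons_cons s t w).trans_lt (hst.trans_lt (half_lt_self hδ)))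
      exact (Real.dist_eq _ _ ▸ this).le
    -- The partial integral of `g` and the cut-off function.
    set G : (Fin d → ℝ) → ℝ := fun w => ∫ t, g (Fin.cons t w) with hG
    have hGint : ∫ w, G w = ∫ w, g w :=
      (integral_fin_succ (hgc.integrable_of_hasCompactSupport hgs)).symm
    have hGc : Continuous G := by
      have h : G = fun w => ∫ t in Set.Icc (-M) M, g (Fin.cons t w) := by
        funext w
        refine (setIntegral_eq_integral_of_forall_compl_eq_zero fun t ht => hzero' w t ?_).symm
        by_contra! hc
        exact ht (abs_le.1 hc)
      rw [h]
      exact continuous_parametric_integral_of_continuous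
        (f := fun (w : Fin d → ℝ) (t : ℝ) => g (Fin.cons t w))
        (hgc.comp continuous_cons_right) isCompact_Icc
    have hG0 : ∀ w, M < ‖w‖ → G w = 0 := fun w hw => by simp [hG, hzero _ w hw]
    have hGs : HasCompactSupport G :=
      HasCompactSupport.intro (isCompact_closedBall 0 M) fun w hw => hG0 w (by
        rwa [Metric.mem_closedBall, dist_zero_right, not_le] at hw)
    set χ : (Fin d → ℝ) → ℝ := fun w => max 0 (M + 1 - ‖w‖) with hχ
    have hχc : Continuous χ := by fun_prop
    have hχs : HasCompactSupport χ :=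
      HasCompactSupport.intro (isCompact_closedBall 0 (M + 1)) fun w hw => by
        rw [Metric.mem_closedBall, dist_zero_right, not_le] at hw
        exact max_eq_left (by linarith)
    have hχ0 : ∀ w, 0 ≤ χ w := fun w => le_max_left _ _
    have hχI : 0 ≤ ∫ w, χ w := integral_nonneg hχ0
    obtain ⟨N₁, h₁⟩ := ih G hGc hGs (η / 2) (by positivity)
    obtain ⟨N₂, h₂⟩ := ih χ hχc hχs 1 one_pos
    obtain ⟨N₃, h₃⟩ := exists_forall_abs_sum_sub_le hβ hε hC hW
      (f := fun (w : Fin d → ℝ) t => g (Fin.cons t w))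
      (fun w => hgc.comp (continuous_cons_right.comp (Continuous.prodMk_right w)))
      hM0 hB0 hzero' (fun w t => hB _) hosc (d + 1)
      (κ := η / (2 * ((∫ w, χ w) + 1))) (by positivity)
    refine ⟨max N₁ (max N₂ N₃), fun N hN L hL hLu => ?_⟩
    rw [max_le_iff, max_le_iff] at hN
    have hL0 : 0 ≤ L := (Real.rpow_nonneg (Nat.cast_nonneg N) _).trans hL.le
    have k₁ := h₁ N hN.1 L hL hLu
    have k₂ := (abs_le.1 (h₂ N hN.2.1 L hL hLu)).2
    have k₃ := h₃ N hN.2.2 L hL hLu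
    set κ := η / (2 * ((∫ w, χ w) + 1)) with hκ
    have hκ0 : 0 < κ := by positivity
    have hpoint : ∀ n ∈ distinctTuples N (d + 1),
        |∑ a ∈ Finset.Icc 1 N \ Finset.univ.image n,
          g (scaledDiff x L N (Fin.cons a n : Fin (d + 2) → ℕ)) - L * G (scaledDiff x L N n)| ≤
        κ * L * χ (scaledDiff x L N n) := by
      intro n _
      simp only [scaledDiff_cons]
      by_cases hn : M < ‖scaledDiff x L N n‖
      · rw [hG0 _ hn, Finset.sum_eq_zero fun a _ => hzero _ _ hn, mul_zero, sub_zero, abs_zero]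
        exact mul_nonneg (by positivity) (hχ0 _)
      · refine (k₃ (scaledDiff x L N n) (x (n 0)) (Finset.univ.image n) ?_).trans ?_
        · simpa using Finset.card_image_le (s := Finset.univ) (f := n)
        · have h1 : 1 ≤ χ (scaledDiff x L N n) :=
            (by linarith : 1 ≤ M + 1 - ‖scaledDiff x L N n‖).trans (le_max_right _ _)
          exact le_mul_of_one_le_right (by positivity) h1
    have hfirst : |∑ n ∈ distinctTuples N (d + 2), g (scaledDiff x L N n) -
        L * ∑ n ∈ distinctTuples N (d + 1), G (scaledDiff x L N n)| ≤
        η / 2 * (N * L ^ (d + 1)) := by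
      rw [sum_distinctTuples_succ, Finset.mul_sum, ← Finset.sum_sub_distrib]
      calc _ ≤ ∑ n ∈ distinctTuples N (d + 1), κ * L * χ (scaledDiff x L N n) :=
            (Finset.abs_sum_le_sum_abs _ _).trans (Finset.sum_le_sum hpoint)
        _ = κ * L * ∑ n ∈ distinctTuples N (d + 1), χ (scaledDiff x L N n) := by
            rw [Finset.mul_sum]
        _ ≤ κ * L * (N * L ^ d * ((∫ w, χ w) + 1)) := by gcongr; linarith
        _ = η / 2 * (N * L ^ (d + 1)) := by rw [hκ]; field_simp; ring
    have hsecond : |L * ∑ n ∈ distinctTuples N (d + 1), G (scaledDiff x L N n) -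
        N * L ^ (d + 1) * ∫ w, g w| ≤ η / 2 * (N * L ^ (d + 1)) := by
      rw [hGint] at k₁
      rw [show L * ∑ n ∈ distinctTuples N (d + 1), G (scaledDiff x L N n) -
        N * L ^ (d + 1) * ∫ w, g w = L * (∑ n ∈ distinctTuples N (d + 1), G (scaledDiff x L N n) -
        N * L ^ d * ∫ w, g w) by ring, abs_mul, abs_of_nonneg hL0]
      calc _ ≤ L * (η / 2 * (N * L ^ d)) := by gcongr
        _ = _ := by ring
    refine (abs_sub_le _ _ _).trans ((add_le_add hfirst hsecond).trans (le_of_eq ?_))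
    ring

theorem correlation_eq_sum_distinctTuples (x : ℕ → ℝ) (d : ℕ) (L : ℝ) (N : ℕ)
    (g : (Fin d → ℝ) → ℝ) :
    correlation x (d + 1) L N g =
      1 / (N : ℝ) * ∑ n ∈ distinctTuples N (d + 1), g (scaledDiff x L N n) := by
  rfl

theorem correlationEstimate_of_abs_windowCount_sub_le {x : ℕ → ℝ} {β ε C : ℝ} (hβ : 0 ≤ β)
    (hε : 0 < ε) (hC : 0 ≤ C)
    (hW : ∀ N : ℕ, 1 ≤ N → ∀ L : ℝ, 0 ≤ L → L ≤ N → ∀ y,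
      |(windowCount x L N y : ℝ) - L| ≤ C * (N : ℝ) ^ (β + ε / 2)) :
    CorrelationEstimate x β ε := by
  intro k hk g hgc hgs hg01 η hη
  obtain ⟨d, rfl⟩ : ∃ d, k = d + 1 := ⟨k - 1, by omega⟩
  change ∃ N₀ : ℕ, ∀ N : ℕ, N₀ ≤ N → ∀ L : ℝ, (N : ℝ) ^ (β + ε) < L → L < (N : ℝ) ^ (1 - ε) →
    |correlation x (d + 1) L N g - L ^ d * ∫ w : Fin d → ℝ, g w| ≤
      η * (L ^ d * ∫ w : Fin d → ℝ, g w)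
  change (Fin d → ℝ) → ℝ at g
  by_cases hg0 : ∃ w, g w ≠ 0
  · obtain ⟨w, hw⟩ := hg0
    have hI : 0 < ∫ w, g w :=
      hgc.integral_pos_of_hasCompactSupport_nonneg_nonzero hgs (fun w => (hg01 w).1) hw
    obtain ⟨N₀, h⟩ := exists_forall_abs_sum_distinctTuples_sub_le hβ hε hC hW d g hgc hgs
      (η * ∫ w, g w) (by positivity)
    refine ⟨max N₀ 1, fun N hN L hL hLu => ?_⟩
    have h1 := h N ((le_max_left _ _).trans hN) L hL hLu
    have hN0 : (0 : ℝ) < N := by exact_mod_cast (le_max_right N₀ 1).trans hN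
    rw [correlation_eq_sum_distinctTuples]
    rw [show 1 / (N : ℝ) * ∑ n ∈ distinctTuples N (d + 1), g (scaledDiff x L N n) -
      L ^ d * ∫ w, g w = (∑ n ∈ distinctTuples N (d + 1), g (scaledDiff x L N n) -
      N * L ^ d * ∫ w, g w) / N by field_simp, abs_div, abs_of_pos hN0, div_le_iff₀ hN0]
    linarith
  · push Not at hg0
    refine ⟨0, fun N _ L _ _ => ?_⟩
    rw [correlation_eq_sum_distinctTuples]
    simp [hg0]

/-- A power saving in the discrepancy implies both estimates. -/
theorem estimates_of_discrepancy_le {x : ℕ → ℝ} (hx : ∀ n : ℕ, 1 ≤ n → x n ∈ Set.Ico (0 : ℝ) 1)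
    {β s ε C : ℝ} (hβ : 0 ≤ β) (hε : 0 < ε) (hs : 1 - s ≤ β + ε / 2)
    (h : ∀ N : ℕ, 1 ≤ N → discrepancy x N ≤ C * (N : ℝ) ^ (-s)) :
    MomentEstimate x β ε ∧ CorrelationEstimate x β ε := by
  have hC : 0 ≤ C := by
    have h1 := (discrepancy_nonneg x 1).trans (h 1 le_rfl)
    simpa using h1
  have hW : ∀ N : ℕ, 1 ≤ N → ∀ L : ℝ, 0 ≤ L → L ≤ N → ∀ y,
      |(windowCount x L N y : ℝ) - L| ≤ 2 * C * (N : ℝ) ^ (β + ε / 2) := by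
    intro N hN L hL hLN y
    have hN0 : (0 : ℝ) < N := by exact_mod_cast hN
    have hN1 : (1 : ℝ) ≤ N := by exact_mod_cast hN
    calc |(windowCount x L N y : ℝ) - L| ≤ 2 * (N * discrepancy x N) :=
          abs_windowCount_sub_le hx hN hL hLN y
      _ ≤ 2 * (N * (C * (N : ℝ) ^ (-s))) := by gcongr; exact h N hN
      _ = 2 * C * (N : ℝ) ^ (1 - s) := by
          rw [sub_eq_add_neg, Real.rpow_add hN0, Real.rpow_one]
          ring
      _ ≤ 2 * C * (N : ℝ) ^ (β + ε / 2) := by gcongr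
  exact ⟨momentEstimate_of_abs_windowCount_sub_le hε (by positivity) hW,
    correlationEstimate_of_abs_windowCount_sub_le hβ hε (by positivity) hW⟩

/-! ### A smoothed Erdős–Turán inequality -/

/-- The sawtooth function `{u} - 1 / 2`. -/
def sawtooth (u : ℝ) : ℝ := Int.fract u - 1 / 2

/-- The `1`-periodic function `{u} ^ 2 - {u}`, which is the second Bernoulli function up to an
additive constant. It is a primitive of twice the sawtooth function. -/
def quadWave (u : ℝ) : ℝ := Int.fract u ^ 2 - Int.fract u

/-- The sawtooth function grows with slope `1` and jumps only downwards, hence it is bounded below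
by its average over an interval to its right, up to half the length of the interval. -/
theorem quadWave_add_sub_le (u : ℝ) {δ : ℝ} (hδ : 0 < δ) (hδ1 : δ ≤ 1) :
    quadWave (u + δ) - quadWave u ≤ 2 * δ * sawtooth u + δ ^ 2 := by
  have h0 := Int.fract_nonneg u
  have h1 := Int.fract_lt_one u
  unfold quadWave sawtooth
  set v := Int.fract u with hv
  have hfr : Int.fract (u + δ) = Int.fract (v + δ) := by
    rw [Int.fract_eq_fract]
    exact ⟨⌊u⌋, by rw [hv, Int.fract]; ring⟩
  rw [hfr]
  rcases lt_or_ge (v + δ) 1 with h | h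
  · rw [Int.fract_eq_self.2 ⟨by linarith, h⟩]
    nlinarith
  · have h2 : Int.fract (v + δ) = v + δ - 1 := by
      rw [← Int.fract_sub_one, Int.fract_eq_self.2 ⟨by linarith, by linarith⟩]
    rw [h2]
    nlinarith

theorem le_quadWave_sub_sub (u : ℝ) {δ : ℝ} (hδ : 0 < δ) (hδ1 : δ ≤ 1) :
    2 * δ * sawtooth u - δ ^ 2 ≤ quadWave u - quadWave (u - δ) := by
  have h0 := Int.fract_nonneg u
  have h1 := Int.fract_lt_one u
  unfold quadWave sawtooth
  set v := Int.fract u with hv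
  have hfr : Int.fract (u - δ) = Int.fract (v - δ) := by
    rw [Int.fract_eq_fract]
    exact ⟨⌊u⌋, by rw [hv, Int.fract]; ring⟩
  rw [hfr]
  rcases le_or_gt 0 (v - δ) with h | h
  · rw [Int.fract_eq_self.2 ⟨h, by linarith⟩]
    nlinarith
  · have h2 : Int.fract (v - δ) = v - δ + 1 := by
      rw [← Int.fract_add_one, Int.fract_eq_self.2 ⟨by linarith, by linarith⟩]
    rw [h2]
    nlinarith

theorem sawtooth_sub_sub_sawtooth_sub {x a b : ℝ} (hx : x ∈ Set.Ico (0 : ℝ) 1) (ha : 0 ≤ a)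
    (hab : a ≤ b) (hb : b ≤ 1) :
    sawtooth (x - b) - sawtooth (x - a) = (if a ≤ x ∧ x < b then 1 else 0) - (b - a) := by
  have key : ∀ c : ℝ, 0 ≤ c → c ≤ 1 →
      Int.fract (x - c) = x - c + if x < c then 1 else 0 := by
    intro c hc0 hc1
    split_ifs with h
    · rw [← Int.fract_add_one, Int.fract_eq_self.2 ⟨by linarith [hx.1], by linarith⟩]
    · rw [Int.fract_eq_self.2 ⟨by linarith, by linarith [hx.2]⟩, add_zero]
  unfold sawtooth
  rw [key a ha (hab.trans hb), key b (ha.trans hab) hb]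
  split_ifs with h1 h2 h3 h3 h2 h3 h3 <;> grind

theorem discrepancy_le_of_sawtooth {x : ℕ → ℝ} (hx : ∀ n : ℕ, 1 ≤ n → x n ∈ Set.Ico (0 : ℝ) 1)
    {N : ℕ} (hN : 1 ≤ N) {E : ℝ}
    (hE : ∀ t, |∑ n ∈ Finset.Icc 1 N, sawtooth (x n - t)| ≤ E) :
    N * discrepancy x N ≤ 2 * E := by
  have hN0 : (0 : ℝ) < N := by exact_mod_cast hN
  have hE0 : 0 ≤ E := (abs_nonneg _).trans (hE 0)
  have hhalf : ∀ a b : ℝ, 0 ≤ a → a ≤ b → b ≤ 1 →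
      |(({n ∈ Finset.Icc 1 N | a ≤ x n ∧ x n < b}.card : ℕ) : ℝ) - N * (b - a)| ≤ 2 * E := by
    intro a b ha hab hb
    have h : (({n ∈ Finset.Icc 1 N | a ≤ x n ∧ x n < b}.card : ℕ) : ℝ) - N * (b - a) =
        ∑ n ∈ Finset.Icc 1 N, sawtooth (x n - b) - ∑ n ∈ Finset.Icc 1 N, sawtooth (x n - a) := by
      rw [← Finset.sum_sub_distrib, Finset.sum_congr rfl fun n hn =>
        sawtooth_sub_sub_sawtooth_sub (hx n (Finset.mem_Icc.1 hn).1) ha hab hb,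
        Finset.sum_sub_distrib, Finset.card_filter]
      simp
      ring
    rw [h]
    refine (abs_sub _ _).trans ?_
    linarith [hE a, hE b]
  rw [mul_comm, ← le_div_iff₀ hN0]
  refine csSup_le ⟨_, 1 / 3, 2 / 3, by norm_num, by norm_num, by norm_num, rfl⟩ ?_
  rintro d ⟨a, b, ha, hab, hb, rfl⟩
  rw [le_div_iff₀ hN0, ← abs_of_pos hN0, ← abs_mul, abs_of_pos hN0, sub_mul,
    div_mul_cancel₀ _ hN0.ne', abs_le]
  constructor
  · -- The left end point is moved into the interval by a small amount.
    refine le_of_forall_pos_le_add fun τ hτ => ?_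
    set ρ := min (τ / N) ((b - a) / 2) with hρ
    have hρ0 : 0 < ρ := lt_min (by positivity) (by linarith)
    have hρ1 : ρ * N ≤ τ := (le_div_iff₀ hN0).1 (min_le_left _ _)
    have hρ2 : ρ ≤ (b - a) / 2 := min_le_right _ _
    have h1 := (abs_le.1 (hhalf (a + ρ) b (by linarith) (by linarith) hb.le)).1
    have h2 : (({n ∈ Finset.Icc 1 N | a + ρ ≤ x n ∧ x n < b}.card : ℕ) : ℝ) ≤
        (({n ∈ Finset.Icc 1 N | a < x n ∧ x n < b}.card : ℕ) : ℝ) := by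
      refine Nat.cast_le.2 (Finset.card_le_card (Finset.monotone_filter_right _ ?_))
      rintro n - ⟨h3, h4⟩
      exact ⟨by linarith, h4⟩
    nlinarith
  · have h1 := (abs_le.1 (hhalf a b ha.le hab.le hb.le)).2
    have h2 : (({n ∈ Finset.Icc 1 N | a < x n ∧ x n < b}.card : ℕ) : ℝ) ≤
        (({n ∈ Finset.Icc 1 N | a ≤ x n ∧ x n < b}.card : ℕ) : ℝ) := by
      refine Nat.cast_le.2 (Finset.card_le_card (Finset.monotone_filter_right _ ?_))
      rintro n - ⟨h3, h4⟩
      exact ⟨h3.le, h4⟩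
    linarith

/-- The character `e(t) = exp (2 π i t)` of `ℝ / ℤ`. -/
def unitExp (t : ℝ) : ℂ := Complex.exp ((2 * Real.pi * t : ℝ) * Complex.I)

theorem norm_unitExp (t : ℝ) : ‖unitExp t‖ = 1 := Complex.norm_exp_ofReal_mul_I _

theorem unitExp_re (t : ℝ) : (unitExp t).re = Real.cos (2 * Real.pi * t) :=
  Complex.exp_ofReal_mul_I_re _

theorem unitExp_im (t : ℝ) : (unitExp t).im = Real.sin (2 * Real.pi * t) :=
  Complex.exp_ofReal_mul_I_im _

theorem unitExp_add (s t : ℝ) : unitExp (s + t) = unitExp s * unitExp t := by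
  rw [unitExp, unitExp, unitExp, ← Complex.exp_add]
  push_cast
  ring_nf

theorem unitExp_add_int (t : ℝ) (m : ℤ) : unitExp (t + m) = unitExp t := by
  rw [unitExp, unitExp, Complex.exp_eq_exp_iff_exists_int]
  exact ⟨m, by push_cast; ring⟩

theorem norm_unitExp_sub_one_le (t : ℝ) : ‖unitExp t - 1‖ ≤ 2 * Real.pi * |t| := by
  have h := Real.norm_exp_I_mul_ofReal_sub_one_le (x := 2 * Real.pi * t)
  rw [mul_comm Complex.I, Real.norm_eq_abs, abs_mul, abs_of_pos Real.two_pi_pos] at h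
  exact h

theorem norm_unitExp_sub_one_le_rpow {t p : ℝ} (ht : 0 ≤ t) (hp0 : 0 ≤ p) (hp1 : p ≤ 1) :
    ‖unitExp t - 1‖ ≤ 2 * Real.pi * t ^ p := by
  rcases le_total t 1 with h | h
  · refine (norm_unitExp_sub_one_le t).trans ?_
    rw [abs_of_nonneg ht]
    gcongr
    rcases ht.eq_or_lt with rfl | ht
    · positivity
    · simpa using Real.rpow_le_rpow_of_exponent_ge ht h hp1
  · have h1 : ‖unitExp t - 1‖ ≤ 2 := by
      refine (norm_sub_le _ _).trans ?_
      rw [norm_unitExp, norm_one]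
      norm_num
    have h2 : 1 ≤ t ^ p := Real.one_le_rpow h hp0
    nlinarith [Real.pi_gt_three]

theorem hasSum_quadWave (u : ℝ) :
    HasSum (fun h : ℕ => 1 / (h : ℝ) ^ 2 * Real.cos (2 * Real.pi * (h * u)))
      (Real.pi ^ 2 * (quadWave u + 1 / 6)) := by
  have h := hasSum_one_div_nat_pow_mul_cos one_ne_zero
    (x := Int.fract u) ⟨Int.fract_nonneg u, (Int.fract_lt_one u).le⟩
  convert h using 1
  · funext k
    rw [mul_one]
    congr 1
    have h1 : 2 * Real.pi * (k * u) =
        2 * Real.pi * k * Int.fract u + ((k * ⌊u⌋ : ℤ) : ℝ) * (2 * Real.pi) := by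
      rw [Int.fract]
      push_cast
      ring
    rw [h1, Real.cos_add_int_mul_two_pi]
  · rw [quadWave]
    simp [Polynomial.bernoulli, Finset.sum_range_succ, Polynomial.eval_add]
    ring

/-- The exponential sum `∑_{n ≤ N} e(h x_n)`. -/
def expSum (x : ℕ → ℝ) (N h : ℕ) : ℂ := ∑ n ∈ Finset.Icc 1 N, unitExp (h * x n)

theorem abs_sum_cos_sub_cos_le (x : ℕ → ℝ) (N h : ℕ) (v : ℝ) {δ p : ℝ} (hδ : 0 ≤ δ) (hp0 : 0 ≤ p)
    (hp1 : p ≤ 1) :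
    |∑ n ∈ Finset.Icc 1 N, (Real.cos (2 * Real.pi * (h * (x n + v + δ))) -
      Real.cos (2 * Real.pi * (h * (x n + v))))| ≤
      2 * Real.pi * (h * δ) ^ p * ‖expSum x N h‖ := by
  have h1 : ∑ n ∈ Finset.Icc 1 N, (Real.cos (2 * Real.pi * (h * (x n + v + δ))) -
      Real.cos (2 * Real.pi * (h * (x n + v)))) =
      ((unitExp (h * δ) - 1) * (unitExp (h * v) * expSum x N h)).re := by
    rw [expSum, Finset.mul_sum, Finset.mul_sum, Complex.re_sum]
    refine Finset.sum_congr rfl fun n _ => ?_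
    rw [← unitExp_re, ← unitExp_re, ← Complex.sub_re]
    congr 1
    rw [← unitExp_add, sub_mul, one_mul, ← unitExp_add]
    ring_nf
  rw [h1]
  refine (Complex.abs_re_le_norm _).trans ?_
  rw [norm_mul, norm_mul, norm_unitExp, one_mul]
  gcongr
  exact norm_unitExp_sub_one_le_rpow (by positivity) hp0 hp1

theorem rpow_neg_one_sub_eq (h : ℕ) {η : ℝ} (hη : 0 < η) :
    1 / (h : ℝ) ^ 2 * (h : ℝ) ^ (1 - η) = (h : ℝ) ^ (-1 - η) := by
  rcases Nat.eq_zero_or_pos h with rfl | hpos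
  · simp [Real.zero_rpow (by linarith : -1 - η ≠ 0)]
  · have h0 : (0 : ℝ) < h := by exact_mod_cast hpos
    rw [one_div, ← Real.rpow_natCast, ← Real.rpow_neg h0.le, ← Real.rpow_add h0]
    congr 1
    push_cast
    ring

theorem summable_rpow_mul_norm_expSum (x : ℕ → ℝ) (N : ℕ) {η : ℝ} (hη : 0 < η) :
    Summable fun h : ℕ => (h : ℝ) ^ (-1 - η) * ‖expSum x N h‖ := by
  refine Summable.of_nonneg_of_le (fun h => by positivity) (fun h => ?_)
    ((Real.summable_nat_rpow.2 (by linarith : -1 - η < -1)).mul_right (N : ℝ))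
  gcongr
  refine (norm_sum_le _ _).trans ?_
  simp [norm_unitExp]

theorem abs_sum_quadWave_sub_le (x : ℕ → ℝ) (N : ℕ) (v : ℝ) {δ η : ℝ} (hδ : 0 ≤ δ) (hη : 0 < η)
    (hη1 : η ≤ 1) :
    |∑ n ∈ Finset.Icc 1 N, (quadWave (x n + v + δ) - quadWave (x n + v))| ≤
      δ ^ (1 - η) * ∑' h : ℕ, (h : ℝ) ^ (-1 - η) * ‖expSum x N h‖ := by
  have hs : HasSum (fun h : ℕ => 1 / (h : ℝ) ^ 2 * ∑ n ∈ Finset.Icc 1 N,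
      (Real.cos (2 * Real.pi * (h * (x n + v + δ))) - Real.cos (2 * Real.pi * (h * (x n + v)))))
      (Real.pi ^ 2 * ∑ n ∈ Finset.Icc 1 N, (quadWave (x n + v + δ) - quadWave (x n + v))) := by
    simp only [Finset.mul_sum]
    refine hasSum_sum fun n _ => ?_
    have h := (hasSum_quadWave (x n + v + δ)).sub (hasSum_quadWave (x n + v))
    simp only [← mul_sub, add_sub_add_right_eq_sub] at h
    exact h
  have hbound : ∀ h : ℕ, ‖1 / (h : ℝ) ^ 2 * ∑ n ∈ Finset.Icc 1 N,
      (Real.cos (2 * Real.pi * (h * (x n + v + δ))) - Real.cos (2 * Real.pi * (h * (x n + v))))‖ ≤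
      2 * Real.pi * δ ^ (1 - η) * ((h : ℝ) ^ (-1 - η) * ‖expSum x N h‖) := by
    intro h
    rw [norm_mul, Real.norm_of_nonneg (by positivity : (0 : ℝ) ≤ 1 / (h : ℝ) ^ 2),
      Real.norm_eq_abs]
    calc _ ≤ 1 / (h : ℝ) ^ 2 * (2 * Real.pi * (h * δ) ^ (1 - η) * ‖expSum x N h‖) := by
          gcongr
          exact abs_sum_cos_sub_cos_le x N h v hδ (by linarith) (by linarith)
      _ = 2 * Real.pi * δ ^ (1 - η) *
          (1 / (h : ℝ) ^ 2 * (h : ℝ) ^ (1 - η) * ‖expSum x N h‖) := by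
          rw [Real.mul_rpow (Nat.cast_nonneg h) hδ]
          ring
      _ = _ := by rw [rpow_neg_one_sub_eq h hη]
  have hle := tsum_of_norm_bounded ((summable_rpow_mul_norm_expSum x N hη).hasSum.mul_left
    (2 * Real.pi * δ ^ (1 - η))) hbound
  rw [hs.tsum_eq, norm_mul, Real.norm_of_nonneg (by positivity), Real.norm_eq_abs] at hle
  set Z := ∑' h : ℕ, (h : ℝ) ^ (-1 - η) * ‖expSum x N h‖
  have hZ : 0 ≤ δ ^ (1 - η) * Z := by
    have : 0 ≤ Z := tsum_nonneg fun h => by positivity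
    positivity
  set A := |∑ n ∈ Finset.Icc 1 N, (quadWave (x n + v + δ) - quadWave (x n + v))|
  have hA : 0 ≤ A := abs_nonneg _
  have hpi := Real.pi_gt_three
  have h2 : Real.pi * (Real.pi * A) ≤ Real.pi * (2 * (δ ^ (1 - η) * Z)) := by nlinarith
  have h3 := le_of_mul_le_mul_left h2 Real.pi_pos
  nlinarith

/-- A smoothed form of the Erdős–Turán inequality. The sawtooth function is compared with
difference quotients of `quadWave` at distance `1 / N`; the Fourier series of the latter converges
absolutely. -/
theorem mul_discrepancy_le {x : ℕ → ℝ} (hx : ∀ n : ℕ, 1 ≤ n → x n ∈ Set.Ico (0 : ℝ) 1)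
    {N : ℕ} (hN : 1 ≤ N) {η : ℝ} (hη : 0 < η) (hη1 : η ≤ 1) :
    N * discrepancy x N ≤
      (N : ℝ) ^ η * (∑' h : ℕ, (h : ℝ) ^ (-1 - η) * ‖expSum x N h‖) + 1 := by
  have hN0 : (0 : ℝ) < N := by exact_mod_cast hN
  have hN1 : (1 : ℝ) ≤ N := by exact_mod_cast hN
  set Z := ∑' h : ℕ, (h : ℝ) ^ (-1 - η) * ‖expSum x N h‖ with hZ
  set δ : ℝ := 1 / N with hδ
  have hδ0 : 0 < δ := by positivity
  have hδ1 : δ ≤ 1 := by rw [hδ, div_le_one hN0]; exact hN1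
  have hNδ : N * δ = 1 := by rw [hδ]; field_simp
  have hpow : δ ^ (1 - η) = δ * (N : ℝ) ^ η := by
    rw [sub_eq_add_neg, Real.rpow_add hδ0, Real.rpow_one, hδ, one_div, Real.inv_rpow hN0.le,
      Real.rpow_neg hN0.le, inv_inv]
  have hsaw : ∀ t, |∑ n ∈ Finset.Icc 1 N, sawtooth (x n - t)| ≤
      ((N : ℝ) ^ η * Z + 1) / 2 := by
    intro t
    have hup : 2 * δ * ∑ n ∈ Finset.Icc 1 N, sawtooth (x n - t) ≤ δ * ((N : ℝ) ^ η * Z + 1) := by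
      have h1 : ∑ n ∈ Finset.Icc 1 N, (2 * δ * sawtooth (x n - t) - δ ^ 2) ≤
          ∑ n ∈ Finset.Icc 1 N, (quadWave (x n + (-t - δ) + δ) - quadWave (x n + (-t - δ))) := by
        refine Finset.sum_le_sum fun n _ => ?_
        have h := le_quadWave_sub_sub (x n - t) hδ0 hδ1
        rwa [show x n + (-t - δ) + δ = x n - t by ring,
          show x n + (-t - δ) = x n - t - δ by ring]
      have h2 := (le_abs_self _).trans (abs_sum_quadWave_sub_le x N (-t - δ) hδ0.le hη hη1)
      rw [Finset.sum_sub_distrib, ← Finset.mul_sum] at h1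
      simp only [Finset.sum_const, Nat.card_Icc, Nat.add_sub_cancel, nsmul_eq_mul] at h1
      rw [hpow] at h2
      nlinarith
    have hlow : -(δ * ((N : ℝ) ^ η * Z + 1)) ≤ 2 * δ * ∑ n ∈ Finset.Icc 1 N, sawtooth (x n - t) := by
      have h1 : ∑ n ∈ Finset.Icc 1 N, (quadWave (x n + -t + δ) - quadWave (x n + -t)) ≤
          ∑ n ∈ Finset.Icc 1 N, (2 * δ * sawtooth (x n - t) + δ ^ 2) := by
        refine Finset.sum_le_sum fun n _ => ?_
        rw [← sub_eq_add_neg]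
        exact quadWave_add_sub_le (x n - t) hδ0 hδ1
      have h2 := neg_le_of_abs_le (abs_sum_quadWave_sub_le x N (-t) hδ0.le hη hη1)
      rw [Finset.sum_add_distrib, ← Finset.mul_sum] at h1
      simp only [Finset.sum_const, Nat.card_Icc, Nat.add_sub_cancel, nsmul_eq_mul] at h1
      rw [hpow] at h2
      nlinarith
    rw [abs_le]
    constructor
    · refine le_of_mul_le_mul_left ?_ (by positivity : 0 < 2 * δ)
      linarith
    · refine le_of_mul_le_mul_left ?_ (by positivity : 0 < 2 * δ)
      linarith
  have h := discrepancy_le_of_sawtooth hx hN hsaw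
  linarith

/-! ### Metric discrepancy bounds -/

/-- The sum of `|∑_{n ∈ I} z_n| ^ 2` over all dyadic subintervals `I` of `[c, c + 2 ^ m)`, that is,
over the intervals obtained from `[c, c + 2 ^ m)` by repeated bisection. -/
def dyadicEnergy (z : ℕ → ℂ) : ℕ → ℕ → ℝ
  | 0, c => ‖z c‖ ^ 2
  | m + 1, c => ‖∑ n ∈ Finset.Ico c (c + 2 ^ (m + 1)), z n‖ ^ 2 +
      (dyadicEnergy z m c + dyadicEnergy z m (c + 2 ^ m))

theorem dyadicEnergy_nonneg (z : ℕ → ℂ) (m c : ℕ) : 0 ≤ dyadicEnergy z m c := by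
  induction m generalizing c with
  | zero => exact sq_nonneg _
  | succ m ih => exact add_nonneg (sq_nonneg _) (add_nonneg (ih _) (ih _))

theorem norm_sum_sq_le_dyadicEnergy (z : ℕ → ℂ) (m c : ℕ) :
    ‖∑ n ∈ Finset.Ico c (c + 2 ^ m), z n‖ ^ 2 ≤ dyadicEnergy z m c := by
  cases m with
  | zero => simp [dyadicEnergy]
  | succ m =>
    exact le_add_of_nonneg_right (add_nonneg (dyadicEnergy_nonneg _ _ _) (dyadicEnergy_nonneg _ _ _))

/-- The maximal inequality behind the Rademacher–Menshov theorem: an initial segment of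
`[c, c + 2 ^ m)` is a disjoint union of at most one dyadic interval of each size. -/
theorem norm_sum_Ico_sq_le (z : ℕ → ℂ) (m : ℕ) : ∀ c N : ℕ, N ≤ 2 ^ m →
    ‖∑ n ∈ Finset.Ico c (c + N), z n‖ ^ 2 ≤ (m + 1) * dyadicEnergy z m c := by
  induction m with
  | zero =>
    intro c N hN
    rw [pow_zero] at hN
    interval_cases N
    · simp [dyadicEnergy]
    · simp [dyadicEnergy]
  | succ m ih =>
    intro c N hN
    have h1 := dyadicEnergy_nonneg z m c
    have h2 := dyadicEnergy_nonneg z m (c + 2 ^ m)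
    have h3 := sq_nonneg ‖∑ n ∈ Finset.Ico c (c + 2 ^ (m + 1)), z n‖
    have hm : (0 : ℝ) ≤ m := Nat.cast_nonneg m
    rw [dyadicEnergy]
    push_cast
    rcases le_or_gt N (2 ^ m) with h | h
    · refine (ih c N h).trans ?_
      nlinarith
    · obtain ⟨K, rfl⟩ := Nat.exists_eq_add_of_le h.le
      have hK : K ≤ 2 ^ m := by
        rw [pow_succ] at hN
        omega
      have hfirst := norm_sum_sq_le_dyadicEnergy z m c
      have hrest := ih (c + 2 ^ m) K hK
      rw [← add_assoc, ← Finset.sum_Ico_consecutive z (Nat.le_add_right c (2 ^ m))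
        (Nat.le_add_right (c + 2 ^ m) K)]
      set A := ∑ n ∈ Finset.Ico c (c + 2 ^ m), z n
      set D := ∑ n ∈ Finset.Ico (c + 2 ^ m) (c + 2 ^ m + K), z n
      -- Cauchy-Schwarz with weights `1` and `m + 1`.
      have hCS : ‖A + D‖ ^ 2 ≤ (m + 2) * (‖A‖ ^ 2 + ‖D‖ ^ 2 / (m + 1)) := by
        have htri : ‖A + D‖ ^ 2 ≤ (‖A‖ + ‖D‖) ^ 2 := by gcongr; exact norm_add_le A D
        have hid : (m + 2) * (‖A‖ ^ 2 + ‖D‖ ^ 2 / (m + 1)) - (‖A‖ + ‖D‖) ^ 2 =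
            ((m + 1) * ‖A‖ - ‖D‖) ^ 2 / (m + 1) := by
          field_simp
          ring
        have : 0 ≤ ((m + 1) * ‖A‖ - ‖D‖) ^ 2 / ((m : ℝ) + 1) := by positivity
        linarith
      have hrest' : ‖D‖ ^ 2 / ((m : ℝ) + 1) ≤ dyadicEnergy z m (c + 2 ^ m) := by
        rw [div_le_iff₀ (by positivity)]
        linarith
      calc _ ≤ ((m : ℝ) + 2) * (‖A‖ ^ 2 + ‖D‖ ^ 2 / (m + 1)) := hCS
        _ ≤ ((m : ℝ) + 2) * (dyadicEnergy z m c + dyadicEnergy z m (c + 2 ^ m)) := by gcongr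
        _ ≤ _ := by nlinarith

theorem integral_cos_two_pi_int_mul (k : ℤ) :
    ∫ α in Set.Icc (0 : ℝ) 1, Real.cos (2 * Real.pi * (k * α)) = if k = 0 then 1 else 0 := by
  rw [integral_Icc_eq_integral_Ioc, ← intervalIntegral.integral_of_le zero_le_one]
  split_ifs with hk
  · simp [hk]
  · have hc : 2 * Real.pi * (k : ℝ) ≠ 0 := by
      have : (k : ℝ) ≠ 0 := by exact_mod_cast hk
      positivity
    simp only [← mul_assoc]
    rw [intervalIntegral.integral_comp_mul_left (fun t => Real.cos t) hc, integral_cos]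
    have hs : Real.sin (2 * Real.pi * k * 1) = 0 := by
      rw [show 2 * Real.pi * (k : ℝ) * 1 = ((2 * k : ℤ) : ℝ) * Real.pi by push_cast; ring]
      exact Real.sin_int_mul_pi _
    rw [hs]
    simp

theorem norm_sum_unitExp_sq {ι : Type*} (s : Finset ι) (θ : ι → ℝ) :
    ‖∑ i ∈ s, unitExp (θ i)‖ ^ 2 =
      ∑ i ∈ s, ∑ j ∈ s, Real.cos (2 * Real.pi * (θ i - θ j)) := by
  rw [Complex.sq_norm, Complex.normSq_apply, Complex.re_sum, Complex.im_sum, Finset.sum_mul_sum,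
    Finset.sum_mul_sum, ← Finset.sum_add_distrib]
  refine Finset.sum_congr rfl fun i _ => ?_
  rw [← Finset.sum_add_distrib]
  refine Finset.sum_congr rfl fun j _ => ?_
  rw [unitExp_re, unitExp_re, unitExp_im, unitExp_im, mul_sub, Real.cos_sub]

theorem continuous_unitExp : Continuous unitExp := by
  unfold unitExp
  fun_prop

theorem integral_norm_sum_unitExp_sq {a : ℕ → ℤ} (ha : Set.InjOn a (Set.Ici 1)) {h : ℕ}
    (hh : h ≠ 0) {s : Finset ℕ} (hs : ∀ n ∈ s, 1 ≤ n) :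
    ∫ α in Set.Icc (0 : ℝ) 1, ‖∑ n ∈ s, unitExp (h * (α * a n))‖ ^ 2 = s.card := by
  have hk : ∀ (i j : ℕ) (α : ℝ), (h : ℝ) * (α * a i) - h * (α * a j) =
      ((h * (a i - a j) : ℤ) : ℝ) * α := by
    intro i j α
    push_cast
    ring
  have hint : ∀ k : ℤ, IntegrableOn (fun α : ℝ => Real.cos (2 * Real.pi * (k * α)))
      (Set.Icc 0 1) := fun k =>
    (by fun_prop : Continuous fun α : ℝ => Real.cos (2 * Real.pi * (k * α))).continuousOn
      |>.integrableOn_compact isCompact_Icc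
  simp only [norm_sum_unitExp_sq, hk]
  rw [integral_finsetSum _ fun i _ => integrable_finsetSum _ fun j _ => hint _]
  have hrow : ∀ i ∈ s, ∫ α in Set.Icc (0 : ℝ) 1, ∑ j ∈ s,
      Real.cos (2 * Real.pi * (((h * (a i - a j) : ℤ) : ℝ) * α)) = 1 := by
    intro i hi
    rw [integral_finsetSum _ fun j _ => hint _]
    simp only [integral_cos_two_pi_int_mul]
    rw [Finset.sum_eq_single_of_mem i hi]
    · simp
    · intro j hj hji
      rw [if_neg]
      intro h0
      rcases mul_eq_zero.1 h0 with h1 | h1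
      · exact hh (by exact_mod_cast h1)
      · exact hji (ha (hs j hj) (hs i hi) (sub_eq_zero.1 h1).symm)
  rw [Finset.sum_congr rfl hrow]
  simp

theorem continuous_dyadicEnergy_unitExp (a : ℕ → ℤ) (h m c : ℕ) :
    Continuous fun α : ℝ => dyadicEnergy (fun n => unitExp (h * (α * a n))) m c := by
  have hc : ∀ n, Continuous fun α : ℝ => unitExp (h * (α * a n)) := fun n =>
    continuous_unitExp.comp (by fun_prop)
  induction m generalizing c with
  | zero => exact ((hc c).norm).pow 2
  | succ m ih =>
    exact ((continuous_finsetSum _ fun n _ => hc n).norm.pow 2).add ((ih _).add (ih _))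

theorem integral_dyadicEnergy_unitExp_le {a : ℕ → ℤ} (ha : Set.InjOn a (Set.Ici 1)) {h : ℕ}
    (hh : h ≠ 0) (m : ℕ) : ∀ c : ℕ, 1 ≤ c →
    ∫ α in Set.Icc (0 : ℝ) 1, dyadicEnergy (fun n => unitExp (h * (α * a n))) m c ≤
      (m + 1) * 2 ^ m := by
  have hint : ∀ m c, IntegrableOn
      (fun α : ℝ => dyadicEnergy (fun n => unitExp (h * (α * a n))) m c) (Set.Icc 0 1) :=
    fun m c => (continuous_dyadicEnergy_unitExp a h m c).continuousOn.integrableOn_compact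
      isCompact_Icc
  induction m with
  | zero =>
    intro c hc
    simp [dyadicEnergy, norm_unitExp]
  | succ m ih =>
    intro c hc
    have hc' : Continuous fun α : ℝ =>
        ‖∑ n ∈ Finset.Ico c (c + 2 ^ (m + 1)), unitExp (h * (α * a n))‖ ^ 2 :=
      (continuous_finsetSum _ fun n _ => continuous_unitExp.comp (by fun_prop)).norm.pow 2
    have h0 := integral_norm_sum_unitExp_sq ha hh (s := Finset.Ico c (c + 2 ^ (m + 1)))
      fun n hn => hc.trans (Finset.mem_Ico.1 hn).1
    rw [Nat.card_Ico, Nat.add_sub_cancel_left] at h0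
    simp only [dyadicEnergy]
    have hadd : IntegrableOn (fun α : ℝ => dyadicEnergy (fun n => unitExp (h * (α * a n))) m c +
        dyadicEnergy (fun n => unitExp (h * (α * a n))) m (c + 2 ^ m)) (Set.Icc 0 1) :=
      (hint m c).add (hint m _)
    rw [integral_add (hc'.continuousOn.integrableOn_compact isCompact_Icc) hadd,
      integral_add (hint m c) (hint m _), h0]
    have h1 := ih c hc
    have h2 := ih (c + 2 ^ m) (hc.trans (Nat.le_add_right _ _))
    push_cast
    rw [pow_succ]
    linarith

/-- A series of non-negative functions with summable integrals converges almost everywhere. -/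
theorem ae_summable_of_summable_integral {Ω ι : Type*} [Countable ι] [MeasurableSpace Ω]
    {μ : Measure Ω} {f : ι → Ω → ℝ} (hf0 : ∀ i ω, 0 ≤ f i ω) (hf : ∀ i, Integrable (f i) μ)
    (hs : Summable fun i => ∫ ω, f i ω ∂μ) : ∀ᵐ ω ∂μ, Summable fun i => f i ω := by
  have hm : ∀ i, AEMeasurable (fun ω => ENNReal.ofReal (f i ω)) μ := fun i =>
    (hf i).aestronglyMeasurable.aemeasurable.ennreal_ofReal
  have hlt : ∫⁻ ω, ∑' i, ENNReal.ofReal (f i ω) ∂μ ≠ ⊤ := by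
    rw [lintegral_tsum hm]
    have h : ∀ i, ∫⁻ ω, ENNReal.ofReal (f i ω) ∂μ = ENNReal.ofReal (∫ ω, f i ω ∂μ) := fun i =>
      (ofReal_integral_eq_lintegral_ofReal (hf i) (ae_of_all _ (hf0 i))).symm
    simp only [h]
    rw [← ENNReal.ofReal_tsum_of_nonneg (fun i => integral_nonneg (hf0 i)) hs]
    exact ENNReal.ofReal_ne_top
  filter_upwards [ae_lt_top' (AEMeasurable.tsum hm) hlt] with ω hω
  have h := ENNReal.summable_toReal hω.ne
  simpa only [ENNReal.toReal_ofReal (hf0 _ ω)] using h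

/-- The weight of the dyadic energy of level `m` at frequency `h`: the factor `m + 1` of the maximal
inequality, a power of `2 ^ m` that outweighs the mean energy `(m + 1) 2 ^ m` when `η > 0`, and the
coefficient of the frequency `h` in `mul_discrepancy_le`. For `η > 0` it vanishes at `h = 0`, where
there is no orthogonality. -/
def energyWeight (η : ℝ) (m h : ℕ) : ℝ :=
  (m + 1) * ((2 : ℝ) ^ m) ^ (-1 - 2 * η) * (h : ℝ) ^ (-1 - η)

theorem energyWeight_nonneg (η : ℝ) (m h : ℕ) : 0 ≤ energyWeight η m h := by
  unfold energyWeight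
  positivity

theorem ae_summable_dyadicEnergy {a : ℕ → ℤ} (ha : Set.InjOn a (Set.Ici 1)) {η : ℝ} (hη : 0 < η) :
    ∀ᵐ α : ℝ ∂(volume.restrict (Set.Icc (0 : ℝ) 1)), Summable fun p : ℕ × ℕ =>
      energyWeight η p.1 p.2 * dyadicEnergy (fun n => unitExp (p.2 * (α * a n))) p.1 1 := by
  refine ae_summable_of_summable_integral
    (fun p α => mul_nonneg (energyWeight_nonneg _ _ _) (dyadicEnergy_nonneg _ _ _))
    (fun p => ((continuous_dyadicEnergy_unitExp a p.2 p.1 1).continuousOn.integrableOn_compact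
      isCompact_Icc).const_mul _) ?_
  set q : ℝ := (2 : ℝ) ^ (-(2 * η)) with hq
  have hq0 : 0 < q := by positivity
  have hq1 : q < 1 := Real.rpow_lt_one_of_one_lt_of_neg one_lt_two (by linarith)
  have hsm : Summable fun m : ℕ => ((m : ℝ) + 1) ^ 2 * q ^ m := by
    have h := (summable_nat_add_iff 1).2 (summable_pow_mul_geometric_of_norm_lt_one (R := ℝ) 2
      (r := q) (by rwa [Real.norm_of_nonneg hq0.le]))
    refine (h.mul_right q⁻¹).congr fun m => ?_
    push_cast
    rw [pow_succ q]
    field_simp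
  have hsh : Summable fun h : ℕ => (h : ℝ) ^ (-1 - η) :=
    Real.summable_nat_rpow.2 (by linarith)
  refine Summable.of_nonneg_of_le (fun p => integral_nonneg fun α =>
    mul_nonneg (energyWeight_nonneg _ _ _) (dyadicEnergy_nonneg _ _ _)) ?_
    (hsm.mul_of_nonneg hsh (fun m => by positivity) (fun h => by positivity))
  rintro ⟨m, h⟩
  rw [integral_const_mul]
  rcases eq_or_ne h 0 with rfl | hh
  · simp [energyWeight, Real.zero_rpow (by linarith : -1 - η ≠ 0)]
  · have hpow : ((2 : ℝ) ^ m) ^ (-1 - 2 * η) * 2 ^ m = q ^ m := by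
      have h2 : (0 : ℝ) < 2 ^ m := by positivity
      rw [sub_eq_add_neg, Real.rpow_add h2, Real.rpow_neg_one, mul_right_comm,
        inv_mul_cancel₀ h2.ne', one_mul, hq, ← Real.rpow_natCast, ← Real.rpow_natCast,
        ← Real.rpow_mul zero_le_two, ← Real.rpow_mul zero_le_two, mul_comm]
    calc _ ≤ energyWeight η m h * ((m + 1) * 2 ^ m) := by
          gcongr
          · exact energyWeight_nonneg _ _ _
          · exact integral_dyadicEnergy_unitExp_le ha hh m 1 le_rfl
      _ = (m + 1) ^ 2 * (((2 : ℝ) ^ m) ^ (-1 - 2 * η) * 2 ^ m) * (h : ℝ) ^ (-1 - η) := by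
          rw [energyWeight]
          ring
      _ = _ := by rw [hpow]

theorem expSum_fract_mul (a : ℕ → ℤ) (α : ℝ) (N h : ℕ) :
    expSum (fun n => Int.fract (α * a n)) N h =
      ∑ n ∈ Finset.Ico 1 (1 + N), unitExp (h * (α * a n)) := by
  have hI : Finset.Icc 1 N = Finset.Ico 1 (1 + N) := by
    ext n
    simp only [Finset.mem_Icc, Finset.mem_Ico]
    omega
  rw [expSum, hI]
  refine Finset.sum_congr rfl fun n _ => ?_
  rw [← unitExp_add_int (h * Int.fract (α * a n)) (h * ⌊α * a n⌋)]
  congr 1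
  rw [Int.fract]
  push_cast
  ring

/-- For a parameter `α` at which the weighted dyadic energies are summable, the smoothed
Erdős–Turán inequality yields square-root cancellation up to a power `N ^ (2 η)`. -/
theorem exists_discrepancy_le_of_summable {a : ℕ → ℤ} {α η : ℝ} (hη : 0 < η) (hη1 : η ≤ 1)
    (hs : Summable fun p : ℕ × ℕ =>
      energyWeight η p.1 p.2 * dyadicEnergy (fun n => unitExp (p.2 * (α * a n))) p.1 1) :
    ∃ C : ℝ, ∀ N : ℕ, 1 ≤ N → discrepancy (fun n => Int.fract (α * a n)) N ≤
      C * (N : ℝ) ^ (-(1 / 2 - 2 * η)) := by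
  set x : ℕ → ℝ := fun n => Int.fract (α * a n) with hx
  have hx01 : ∀ n : ℕ, 1 ≤ n → x n ∈ Set.Ico (0 : ℝ) 1 := fun n _ =>
    ⟨Int.fract_nonneg _, Int.fract_lt_one _⟩
  set F : ℕ × ℕ → ℝ := fun p =>
    energyWeight η p.1 p.2 * dyadicEnergy (fun n => unitExp (p.2 * (α * a n))) p.1 1 with hF
  have hF0 : ∀ p, 0 ≤ F p := fun p =>
    mul_nonneg (energyWeight_nonneg _ _ _) (dyadicEnergy_nonneg _ _ _)
  set K := ∑' p, F p with hK
  have hK0 : 0 ≤ K := tsum_nonneg hF0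
  have hsh : Summable fun h : ℕ => (h : ℝ) ^ (-1 - η) := Real.summable_nat_rpow.2 (by linarith)
  set Z₀ := ∑' h : ℕ, (h : ℝ) ^ (-1 - η) with hZ₀
  have hZ₀0 : 0 ≤ Z₀ := tsum_nonneg fun h => by positivity
  refine ⟨Z₀ + 2 ^ (1 + 2 * η) * K + 1, fun N hN => ?_⟩
  have hN0 : (0 : ℝ) < N := by exact_mod_cast hN
  have hN1 : (1 : ℝ) ≤ N := by exact_mod_cast hN
  -- The least power of two that is at least `N`.
  obtain ⟨m, hm, hm2⟩ : ∃ m : ℕ, N ≤ 2 ^ m ∧ 2 ^ m ≤ 2 * N := by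
    refine ⟨Nat.clog 2 N, Nat.le_pow_clog one_lt_two N, ?_⟩
    rcases hN.eq_or_lt with rfl | h
    · simp
    · have h1 := Nat.pow_pred_clog_lt_self one_lt_two h
      have h2 : Nat.clog 2 N = (Nat.clog 2 N).pred + 1 :=
        (Nat.succ_pred_eq_of_pos (Nat.clog_pos one_lt_two h)).symm
      rw [h2, pow_succ]
      omega
  set T : ℝ := (2 : ℝ) ^ m with hT
  have hT0 : 0 < T := by positivity
  have hT2 : T ≤ 2 * N := by rw [hT]; exact_mod_cast hm2
  have hslice : Summable fun h : ℕ => F (m, h) := hs.prod_factor m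
  have hsliceK : ∑' h : ℕ, F (m, h) ≤ K :=
    Summable.tsum_le_tsum_of_inj (fun h : ℕ => (m, h)) (fun _ _ h => (Prod.mk.inj h).2)
      (fun p _ => hF0 p) (fun _ => le_rfl) hslice hs
  -- The expected size of the exponential sums.
  set lam : ℝ := (N : ℝ) ^ (1 / 2 + η) with hlam
  have hlam0 : 0 < lam := by positivity
  -- The inequality of the arithmetic and the geometric mean, frequency by frequency.
  have hpt : ∀ h : ℕ, (h : ℝ) ^ (-1 - η) * ‖expSum x N h‖ ≤
      lam * (h : ℝ) ^ (-1 - η) + lam⁻¹ * T ^ (1 + 2 * η) * F (m, h) := by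
    intro h
    have h1 := norm_sum_Ico_sq_le (fun n => unitExp (h * (α * a n))) m 1 N hm
    rw [← expSum_fract_mul] at h1
    have h2 : T ^ (1 + 2 * η) * F (m, h) = (h : ℝ) ^ (-1 - η) *
        ((m + 1) * dyadicEnergy (fun n => unitExp (h * (α * a n))) m 1) := by
      have h3 : T ^ (1 + 2 * η) * T ^ (-1 - 2 * η) = 1 := by
        rw [← Real.rpow_add hT0]
        simp
      calc _ = (T ^ (1 + 2 * η) * T ^ (-1 - 2 * η)) * ((h : ℝ) ^ (-1 - η) *
            ((m + 1) * dyadicEnergy (fun n => unitExp (h * (α * a n))) m 1)) := by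
            simp only [hF, energyWeight, hT]
            ring
        _ = _ := by rw [h3, one_mul]
    rw [mul_assoc, h2]
    have h4 : ‖expSum x N h‖ ≤ lam + lam⁻¹ * ‖expSum x N h‖ ^ 2 := by
      have h5 : lam + lam⁻¹ * ‖expSum x N h‖ ^ 2 - ‖expSum x N h‖ =
          lam⁻¹ * ((lam - ‖expSum x N h‖ / 2) ^ 2 + 3 / 4 * ‖expSum x N h‖ ^ 2) := by
        field_simp
        ring
      have h6 : 0 ≤ lam⁻¹ * ((lam - ‖expSum x N h‖ / 2) ^ 2 + 3 / 4 * ‖expSum x N h‖ ^ 2) := by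
        positivity
      linarith
    calc _ ≤ (h : ℝ) ^ (-1 - η) * (lam + lam⁻¹ *
          ((m + 1) * dyadicEnergy (fun n => unitExp (h * (α * a n))) m 1)) := by
          gcongr
          exact h4.trans (by gcongr)
      _ = _ := by ring
  have hsum : ∑' h : ℕ, (h : ℝ) ^ (-1 - η) * ‖expSum x N h‖ ≤
      lam * Z₀ + lam⁻¹ * T ^ (1 + 2 * η) * K := by
    refine ((summable_rpow_mul_norm_expSum x N hη).tsum_le_tsum hpt
      ((hsh.mul_left lam).add (hslice.mul_left _))).trans ?_
    rw [(hsh.mul_left lam).tsum_add (hslice.mul_left _), tsum_mul_left, tsum_mul_left]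
    gcongr
  have hTN : lam⁻¹ * T ^ (1 + 2 * η) ≤ 2 ^ (1 + 2 * η) * lam := by
    rw [inv_mul_le_iff₀ hlam0]
    calc T ^ (1 + 2 * η) ≤ (2 * N) ^ (1 + 2 * η) := by gcongr
      _ = 2 ^ (1 + 2 * η) * (N : ℝ) ^ (1 / 2 + η + (1 / 2 + η)) := by
          rw [Real.mul_rpow zero_le_two hN0.le]
          ring_nf
      _ = lam * (2 ^ (1 + 2 * η) * lam) := by
          rw [Real.rpow_add hN0]
          ring
  have hpow : (N : ℝ) ^ η * lam = N * (N : ℝ) ^ (-(1 / 2 - 2 * η)) := by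
    nth_rewrite 2 [← Real.rpow_one (N : ℝ)]
    rw [hlam, ← Real.rpow_add hN0, ← Real.rpow_add hN0]
    ring_nf
  have hone : 1 ≤ (N : ℝ) ^ η * lam :=
    one_le_mul_of_one_le_of_one_le (Real.one_le_rpow hN1 hη.le)
      (Real.one_le_rpow hN1 (by linarith))
  refine le_of_mul_le_mul_left ?_ hN0
  calc N * discrepancy x N
      ≤ (N : ℝ) ^ η * (∑' h : ℕ, (h : ℝ) ^ (-1 - η) * ‖expSum x N h‖) + 1 :=
        mul_discrepancy_le hx01 hN hη hη1
    _ ≤ (N : ℝ) ^ η * (lam * Z₀ + 2 ^ (1 + 2 * η) * lam * K) + (N : ℝ) ^ η * lam := by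
        gcongr
        exact hsum.trans (by gcongr)
    _ = ((N : ℝ) ^ η * lam) * (Z₀ + 2 ^ (1 + 2 * η) * K + 1) := by ring
    _ = N * ((Z₀ + 2 ^ (1 + 2 * η) * K + 1) * (N : ℝ) ^ (-(1 / 2 - 2 * η))) := by
        rw [hpow]
        ring

end

theorem mainTheorem7 :
    (∀ (x : ℕ → ℝ) (γ : ℝ), (∀ n : ℕ, 1 ≤ n → x n ∈ Set.Ico (0 : ℝ) 1) → 0 < γ →
      IsLUB {s : ℝ | 0 < s ∧ ∃ C : ℝ, ∀ N : ℕ, 1 ≤ N → discrepancy x N ≤ C * (N : ℝ) ^ (-s)} γ →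
      ∀ ε : ℝ, 0 < ε → MomentEstimate x (1 - γ) ε ∧ CorrelationEstimate x (1 - γ) ε) ∧
    (∀ a : ℕ → ℤ, StrictMonoOn a (Set.Ici 1) →
      ∀ᵐ α : ℝ ∂(MeasureTheory.volume.restrict (Set.Icc (0 : ℝ) 1)), ∀ ε : ℝ, 0 < ε →
        MomentEstimate (fun n => Int.fract (α * a n)) (1 / 2) ε ∧
        CorrelationEstimate (fun n => Int.fract (α * a n)) (1 / 2) ε) := by
  constructor
  · intro x γ hx _ hγ ε hε
    have hγ1 : γ ≤ 1 := hγ.2 fun s hs =>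
      hs.2.elim fun C hC => exponent_le_one_of_discrepancy_le hx hC
    obtain ⟨s, ⟨_, C, hC⟩, hs, _⟩ := hγ.exists_between (by linarith : γ - ε / 2 < γ)
    exact estimates_of_discrepancy_le hx (by linarith) hε (by linarith) hC
  · intro a ha
    have hae : ∀ᵐ α : ℝ ∂(volume.restrict (Set.Icc (0 : ℝ) 1)), ∀ j : ℕ, Summable fun p : ℕ × ℕ =>
        energyWeight (1 / ((j : ℝ) + 1)) p.1 p.2 *
          dyadicEnergy (fun n => unitExp (p.2 * (α * a n))) p.1 1 :=
      ae_all_iff.2 fun j => ae_summable_dyadicEnergy ha.injOn (by positivity)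
    filter_upwards [hae] with α hα ε hε
    obtain ⟨j, hj⟩ := exists_nat_one_div_lt (by positivity : 0 < ε / 4)
    have hj1 : 1 / ((j : ℝ) + 1) ≤ 1 := by
      rw [div_le_one (by positivity)]
      linarith [(Nat.cast_nonneg j : (0 : ℝ) ≤ j)]
    obtain ⟨C, hC⟩ := exists_discrepancy_le_of_summable (by positivity) hj1 (hα j)
    exact estimates_of_discrepancy_le (fun n _ => ⟨Int.fract_nonneg _, Int.fract_lt_one _⟩)
      (by norm_num) hε (by linarith) hC
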